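/- Let $\mathcal B$ be a real or complex Banach space which is either reflexive and separable, or a Hilbert space. Let $Z:\mathcal B\supset D(Z)\to\mathcal B$ be a linear operator with dense domain $D(Z)$, and let $t>0$. Notation: $\mathcal L(E)$ is the space of bounded linear operators on a normed space $E$. For $S:[0,\infty)\to\mathcal L(E)$, $S'(0)$ denotes the linear operator $S'(0)\psi=\lim_{h\to0+}h^{-1}(S(h)\psi-S(0)\psi)$ (norm limit) whose domain $D(S'(0))$ is the set of all $\psi\in E$ for which the limit exists. $F^*(s)=(F(s))^*$ is the adjoint operator on the dual space $\mathcal B^*$, and $[x]$ is the integer part of $x$. A $C_0$-semigroup is a strongly continuous function $T:[0,\infty)\to\mathcal L(\mathcal B)$ with $T(0)=I$, $T(l+m)=T(l)T(m)$ and $\|T(s)\|\le Me^{as}$ for some $M>1$, $a\in\mathbb R$; its generator is $T'(0)$, and $\exp(sA)$, $s\ge0$, denotes the $C_0$-semigroup generated by $A$. The operator $Z$ is closable and its closure $\overline Z$ is the generator of a $C_0$-semigroup if and only if there exists a function $F:[0,\infty)\to\mathcal L(\mathcal B)$ such that: (i) $F(0)=I$, and there exist $a\in\mathbb R$ and $M\ge1$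 such that $\|F(s/n)^m\|\le M\exp(as\,m/n)$ for all integers $n,m\ge1$ and all $s\ge0$; (ii) $D(Z)\subseteq D(F'(0))$ and $F'(0)f=Zf$ for all $f\in D(Z)$; (iii) $D((F^*)'(0))$ is weak-* dense in $\mathcal B^*$; (iv) there exists a dense linear subspace $A\subseteq D(Z)$ of $\mathcal B$ such that for all $f\in A$ and $s\ge0$ there exists a sequence $(f_n)_{n\ge1}$ in $D(Z)$ with $\lim_{n\to\infty}\|F(t/n)^{[ns]}f-f_n\|=0$ and $(Zf_n)_{n\ge1}$ bounded. Furthermore, whenever $F$ satisfies (i)–(iv), $\exp(s\overline Z)f=\lim_{n\to\infty}F(s/n)^nf$ for all $s>0$ and $f\in\mathcal B$. -/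

import Mathlib

open Filter Topology
open scoped NNReal

namespace ChernoffGen

noncomputable section

/-- The (strong) derivative at the point `0` of `S : [0, ∞) → L(E)`: the linear operator whose
domain is the space of all `ψ` for which `h⁻¹ (S(h)ψ - S(0)ψ)` converges in norm as `h → 0`,
`h > 0`, and whose value at such a `ψ` is the limit. -/
def derivAtZero {𝕜 E : Type*} [RCLike 𝕜] [NormedAddCommGroup E] [NormedSpace 𝕜 E]
    (S : ℝ≥0 → E →L[𝕜] E) : E →ₗ.[𝕜] E where
  domain :=
    { carrier := {ψ | ∃ y : E, Tendsto (fun h : ℝ≥0 => (((h : ℝ) : 𝕜))⁻¹ • (S h ψ - S 0 ψ))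
        (𝓝[>] 0) (𝓝 y)}
      add_mem' := by
        rintro x x' ⟨y, hy⟩ ⟨y', hy'⟩
        refine ⟨y + y', (hy.add hy').congr fun h => ?_⟩
        rw [← smul_add, map_add, map_add, add_sub_add_comm]
      zero_mem' := ⟨0, by simp⟩
      smul_mem' := by
        rintro c x ⟨y, hy⟩
        refine ⟨c • y, (hy.const_smul c).congr fun h => ?_⟩
        rw [map_smul, map_smul, ← smul_sub, smul_comm] }
  toFun :=
    { toFun := fun ψ => Classical.choose ψ.2
      map_add' := by
        intro x x'
        refine tendsto_nhds_unique (Classical.choose_spec (x + x').2)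
          (((Classical.choose_spec x.2).add (Classical.choose_spec x'.2)).congr fun h => ?_)
        rw [← smul_add, Submodule.coe_add, map_add, map_add, add_sub_add_comm]
      map_smul' := by
        intro c x
        refine tendsto_nhds_unique (Classical.choose_spec (c • x).2)
          (((Classical.choose_spec x.2).const_smul c).congr fun h => ?_)
        rw [Submodule.coe_smul, map_smul, map_smul, ← smul_sub, smul_comm] }

theorem derivAtZero_tendsto {𝕜 E : Type*} [RCLike 𝕜] [NormedAddCommGroup E] [NormedSpace 𝕜 E]
    (S : ℝ≥0 → E →L[𝕜] E) (ψ : (derivAtZero S).domain) :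
    Tendsto (fun h : ℝ≥0 => (((h : ℝ) : 𝕜))⁻¹ • (S h ψ - S 0 ψ)) (𝓝[>] 0)
      (𝓝 (derivAtZero S ψ)) :=
  Classical.choose_spec ψ.2

/-- `S^*`, with `S^*(s) = (S(s))^*` the dual operator `φ ↦ φ ∘ S(s)` on the dual space. -/
def dualFamily {𝕜 E : Type*} [RCLike 𝕜] [NormedAddCommGroup E] [NormedSpace 𝕜 E]
    (S : ℝ≥0 → E →L[𝕜] E) : ℝ≥0 → StrongDual 𝕜 E →L[𝕜] StrongDual 𝕜 E :=
  fun s => ContinuousLinearMap.precomp 𝕜 (S s)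

/-- A `C_0`-semigroup. Continuity refers to the strong operator topology. -/
structure IsC0Semigroup {𝕜 E : Type*} [RCLike 𝕜] [NormedAddCommGroup E] [NormedSpace 𝕜 E]
    (T : ℝ≥0 → E →L[𝕜] E) : Prop where
  map_zero : T 0 = 1
  map_add : ∀ l m : ℝ≥0, T (l + m) = T l * T m
  continuous : ∀ f : E, Continuous fun s => T s f
  bound : ∃ M a : ℝ, 1 < M ∧ ∀ s : ℝ≥0, ‖T s‖ ≤ M * Real.exp (a * s)

/-- `Z` is the generator of the `C_0`-semigroup `T`. -/
def IsGeneratorOf {𝕜 E : Type*} [RCLike 𝕜] [NormedAddCommGroup E] [NormedSpace 𝕜 E]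
    (Z : E →ₗ.[𝕜] E) (T : ℝ≥0 → E →L[𝕜] E) : Prop :=
  IsC0Semigroup T ∧ Z = derivAtZero T

/-- The canonical embedding into the second dual is onto. -/
def IsReflexiveSpace (𝕜 E : Type*) [RCLike 𝕜] [NormedAddCommGroup E] [NormedSpace 𝕜 E] : Prop :=
  Function.Surjective (NormedSpace.inclusionInDoubleDual 𝕜 E)

/-- The norm of the normed space `E` comes from an inner product
(for complete `E`: `E` is a Hilbert space). -/
def HasInnerProduct (𝕜 E : Type*) [RCLike 𝕜] [NormedAddCommGroup E]
    [inst : NormedSpace 𝕜 E] : Prop :=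
  ∃ ip : InnerProductSpace 𝕜 E, ip.toNormedSpace = inst

/-- The four conditions on the function `F`, for the operator `Z` and the number `t`. -/
structure Conditions {𝕜 E : Type*} [RCLike 𝕜] [NormedAddCommGroup E] [NormedSpace 𝕜 E]
    (Z : E →ₗ.[𝕜] E) (t : ℝ≥0) (F : ℝ≥0 → E →L[𝕜] E) : Prop where
  map_zero : F 0 = 1
  stable : ∃ a M : ℝ, 1 ≤ M ∧ ∀ n m : ℕ, 1 ≤ n → 1 ≤ m → ∀ s : ℝ≥0,
    ‖F (s / n) ^ m‖ ≤ M * Real.exp (a * s * (m / n))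
  /-- `D(Z) ⊆ D(F'(0))` and `F'(0) f = Z f` for all `f ∈ D(Z)`. -/
  extends_Z : Z ≤ derivAtZero F
  /-- `D((F^*)'(0))` is weak-* dense in the dual space. -/
  dual_dense : Dense {φ : WeakDual 𝕜 E |
    WeakDual.toStrongDual φ ∈ (derivAtZero (dualFamily F)).domain}
  approx : ∃ A : Submodule 𝕜 E, A ≤ Z.domain ∧ Dense (A : Set E) ∧
    ∀ f ∈ A, ∀ s : ℝ≥0, ∃ g : ℕ → Z.domain,
      Tendsto (fun n : ℕ => ‖(F (t / n) ^ ⌊(n : ℝ≥0) * s⌋₊) f - (g n : E)‖) atTop (𝓝 0) ∧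
      Bornology.IsBounded (Set.range fun n => Z (g n))

end

end ChernoffGen

namespace ChernoffGen

noncomputable section

section FunctionalAnalysis

variable {𝕜 E : Type*} [RCLike 𝕜] [NormedAddCommGroup E] [NormedSpace 𝕜 E]

/-- A subspace is dense as soon as only the zero functional annihilates it. -/
theorem dense_of_forall_dual_eq_zero (p : Submodule 𝕜 E)
    (h : ∀ φ : StrongDual 𝕜 E, (∀ x ∈ p, φ x = 0) → φ = 0) : Dense (p : Set E) := by
  intro x
  by_contra hx
  have hx' : x ∉ p.topologicalClosure := hx
  have : IsClosed (p.topologicalClosure : Set E) := p.isClosed_topologicalClosure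
  have hne : ‖(Submodule.Quotient.mk x : E ⧸ p.topologicalClosure)‖ ≠ 0 := by
    rw [norm_ne_zero_iff]
    simpa [Submodule.Quotient.mk_eq_zero] using hx'
  obtain ⟨g, -, hg⟩ := exists_dual_vector 𝕜 _ hne
  have h0 := h (g.comp p.topologicalClosure.mkQL) (fun y hy => by
    have : p.topologicalClosure.mkQL y = 0 := by
      simpa using p.le_topologicalClosure hy
    simp [this])
  have h1 := congrArg (fun φ : StrongDual 𝕜 E => φ x) h0
  have h2 : g (Submodule.Quotient.mk x) = 0 := h1
  rw [hg] at h2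
  exact hne (by exact_mod_cast h2)

theorem isReflexiveSpace_of_hasInnerProduct [CompleteSpace E] (h : HasInnerProduct 𝕜 E) :
    IsReflexiveSpace 𝕜 E := by
  obtain ⟨ip, rfl⟩ := h
  intro Φ
  let g : StrongDual 𝕜 E := LinearMap.mkContinuous
    { toFun := fun y => (starRingEnd 𝕜) (Φ (InnerProductSpace.toDual 𝕜 E y))
      map_add' := by intro x y; simp
      map_smul' := by intro c x; simp [map_smulₛₗ] } ‖Φ‖ (by
        intro x
        have := Φ.le_opNorm (InnerProductSpace.toDual 𝕜 E x)
        simpa using this)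
  refine ⟨(InnerProductSpace.toDual 𝕜 E).symm g, ?_⟩
  ext φ
  obtain ⟨y, rfl⟩ := (InnerProductSpace.toDual 𝕜 E).surjective φ
  rw [NormedSpace.dual_def, InnerProductSpace.toDual_apply_apply, ← inner_conj_symm,
    InnerProductSpace.toDual_symm_apply]
  exact RCLike.conj_conj _

/-- Bounded sequences in reflexive spaces converge weakly along ultrafilters. -/
theorem exists_weak_limit (hE : IsReflexiveSpace 𝕜 E) (U : Ultrafilter ℕ) {x : ℕ → E} {C : ℝ}
    (hx : ∀ᶠ n in U, ‖x n‖ ≤ C) :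
    ∃ y : E, ∀ φ : StrongDual 𝕜 E, Tendsto (fun n => φ (x n)) U (𝓝 (φ y)) := by
  let j : ℕ → WeakDual 𝕜 (StrongDual 𝕜 E) := fun n =>
    StrongDual.toWeakDual (NormedSpace.inclusionInDoubleDual 𝕜 E (x n))
  have hK := WeakDual.isCompact_closedBall (𝕜 := 𝕜) (E := StrongDual 𝕜 E) 0 C
  have hmem : ∀ᶠ n in U, j n ∈ WeakDual.toStrongDual ⁻¹' Metric.closedBall
      (0 : StrongDual 𝕜 (StrongDual 𝕜 E)) C := by
    filter_upwards [hx] with n hn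
    refine (mem_closedBall_zero_iff (E := StrongDual 𝕜 (StrongDual 𝕜 E))).2 ?_
    exact (NormedSpace.double_dual_bound 𝕜 E (x n)).trans hn
  obtain ⟨Φ, -, hΦ⟩ := hK.ultrafilter_le_nhds (U.map j) (le_principal_iff.2 hmem)
  obtain ⟨y, hy⟩ := hE (WeakDual.toStrongDual Φ)
  refine ⟨y, fun φ => ?_⟩
  have h1 : Tendsto j U (𝓝 Φ) := hΦ
  have h2 := ((WeakDual.eval_continuous φ).tendsto Φ).comp h1
  have h3 : Φ φ = φ y := by
    rw [← NormedSpace.dual_def 𝕜 E y φ, hy]; rfl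
  rw [h3] at h2
  exact h2

theorem eq_of_forall_dual_eq {x y : E} (h : ∀ φ : StrongDual 𝕜 E, φ x = φ y) : x = y :=
  (SeparatingDual.eq_iff_forall_dual_eq (R := 𝕜)).2 h

/-- A weak-* dense subspace of the dual of a reflexive space is norm dense. -/
theorem dense_of_weak_star_dense (hE : IsReflexiveSpace 𝕜 E) (p : Submodule 𝕜 (StrongDual 𝕜 E))
    (hp : Dense {φ : WeakDual 𝕜 E | WeakDual.toStrongDual φ ∈ p}) :
    Dense (p : Set (StrongDual 𝕜 E)) := by
  refine dense_of_forall_dual_eq_zero p fun Φ hΦ => ?_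
  obtain ⟨x, rfl⟩ := hE Φ
  have hcl : IsClosed {φ : WeakDual 𝕜 E | φ x = 0} :=
    isClosed_eq (WeakDual.eval_continuous x) continuous_const
  have hall : ∀ φ : WeakDual 𝕜 E, φ x = 0 := fun φ =>
    (hcl.closure_subset_iff.2 (fun ψ hψ => hΦ _ hψ)) (hp φ)
  ext φ
  exact hall (StrongDual.toWeakDual φ)

/-- Strong convergence of a bounded family of operators only has to be checked on a dense set. -/
theorem tendsto_of_dense {F ι : Type*} [NormedAddCommGroup F] [NormedSpace 𝕜 F]
    {l : Filter ι} {L : ι → E →L[𝕜] F} {L' : E →L[𝕜] F} {C : ℝ}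
    (hC : ∀ᶠ i in l, ‖L i‖ ≤ C) {D : Set E} (hD : Dense D)
    (h : ∀ x ∈ D, Tendsto (fun i => L i x) l (𝓝 (L' x))) (x : E) :
    Tendsto (fun i => L i x) l (𝓝 (L' x)) := by
  rw [Metric.tendsto_nhds]
  intro ε hε
  set K := |C| + ‖L'‖ + 1 with hK
  have hKpos : 0 < K := by positivity
  obtain ⟨y, hyD, hy⟩ := Metric.mem_closure_iff.1 (hD x) (ε / (2 * K)) (by positivity)
  filter_upwards [hC, Metric.tendsto_nhds.1 (h y hyD) (ε / 2) (by positivity)] with i hi h2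
  rw [dist_eq_norm] at *
  have e : L i x - L' x = (L i y - L' y) + (L i (x - y) - L' (x - y)) := by
    rw [map_sub, map_sub]; abel
  have b : ‖L i (x - y) - L' (x - y)‖ ≤ K * ‖x - y‖ := by
    have b1 := (L i).le_opNorm (x - y)
    have b2 := L'.le_opNorm (x - y)
    have b3 := norm_sub_le (L i (x - y)) (L' (x - y))
    have b4 : ‖L i‖ * ‖x - y‖ ≤ |C| * ‖x - y‖ := by
      gcongr; exact hi.trans (le_abs_self C)
    nlinarith [norm_nonneg (x - y)]
  have b' : K * ‖x - y‖ < ε / 2 := by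
    calc K * ‖x - y‖ < K * (ε / (2 * K)) := by gcongr
      _ = ε / 2 := by field_simp
  rw [e]
  linarith [norm_add_le (L i y - L' y) (L i (x - y) - L' (x - y))]

/-- A bounded family of operators that converges on a dense set converges strongly. -/
theorem exists_strong_limit {F ι : Type*} [NormedAddCommGroup F] [NormedSpace 𝕜 F]
    [CompleteSpace E] [CompleteSpace F]
    {l : Filter ι} [l.NeBot] [l.IsCountablyGenerated] {L : ι → E →L[𝕜] F} {C : ℝ}
    (hC : ∀ᶠ i in l, ‖L i‖ ≤ C) {D : Set E} (hD : Dense D)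
    (h : ∀ x ∈ D, ∃ y, Tendsto (fun i => L i x) l (𝓝 y)) :
    ∃ L' : E →L[𝕜] F, ∀ x, Tendsto (fun i => L i x) l (𝓝 (L' x)) := by
  have key : ∀ x, ∃ y, Tendsto (fun i => L i x) l (𝓝 y) := by
    intro x
    apply cauchy_map_iff_exists_tendsto.1
    rw [Metric.cauchy_iff]
    refine ⟨inferInstance, fun ε hε => ?_⟩
    set K := |C| + 1 with hK
    have hKpos : 0 < K := by positivity
    obtain ⟨y, hyD, hy⟩ := Metric.mem_closure_iff.1 (hD x) (ε / (4 * K)) (by positivity)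
    obtain ⟨z, hz⟩ := h y hyD
    have hev : ∀ᶠ i in l, dist (L i x) z < ε / 2 := by
      filter_upwards [hC, Metric.tendsto_nhds.1 hz (ε / 4) (by positivity)] with i hi h2
      have b1 := (L i).le_opNorm (x - y)
      rw [map_sub, ← dist_eq_norm, ← dist_eq_norm] at b1
      have b4 : ‖L i‖ * dist x y ≤ K * dist x y := by
        gcongr; linarith [le_abs_self C]
      have b' : K * dist x y < ε / 4 := by
        calc K * dist x y < K * (ε / (4 * K)) := by gcongr
          _ = ε / 4 := by field_simp
      linarith [dist_triangle (L i x) (L i y) z]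
    refine ⟨(fun i => L i x) '' {i | dist (L i x) z < ε / 2}, image_mem_map hev, ?_⟩
    rintro _ ⟨i, hi, rfl⟩ _ ⟨k, hk, rfl⟩
    change dist _ _ < _ at hi hk
    linarith [dist_triangle_right (L i x) (L k x) z]
  choose f hf using key
  exact ⟨continuousLinearMapOfTendsto L (tendsto_pi_nhds.2 hf), hf⟩

/-- Strong convergence of a bounded family of operators is uniform on compact sets. -/
theorem eventually_forall_image_lt {F ι : Type*} [NormedAddCommGroup F] [NormedSpace 𝕜 F]
    {X : Type*} [TopologicalSpace X] {K : Set X} (hK : IsCompact K) {z : X → E}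
    (hz : Continuous z) {l : Filter ι} {L : ι → E →L[𝕜] F} {L' : E →L[𝕜] F} {C : ℝ}
    (hC : ∀ᶠ i in l, ‖L i‖ ≤ C) (h : ∀ x, Tendsto (fun i => L i x) l (𝓝 (L' x)))
    {ε : ℝ} (hε : 0 < ε) :
    ∀ᶠ i in l, ∀ r ∈ K, ‖L i (z r) - L' (z r)‖ < ε := by
  have hu : TendstoUniformlyOn (fun i r => L i (z r)) (fun r => L' (z r)) l K := by
    rw [← tendstoLocallyUniformlyOn_iff_tendstoUniformlyOn_of_compact hK]
    rw [Metric.tendstoLocallyUniformlyOn_iff]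
    intro δ hδ r hr
    set k := |C| + ‖L'‖ + 1 with hk
    have hkpos : 0 < k := by positivity
    refine ⟨{r' | dist (z r') (z r) < δ / (2 * k)}, mem_nhdsWithin_of_mem_nhds
      ((Metric.continuous_iff'.1 hz) r _ (by positivity)), ?_⟩
    filter_upwards [hC, Metric.tendsto_nhds.1 (h (z r)) (δ / 2) (by positivity)] with i hi h2
    intro r' hr'
    change dist _ _ < _ at hr'
    rw [dist_comm]
    rw [dist_eq_norm] at *
    have e : L i (z r') - L' (z r') =
        (L i (z r) - L' (z r)) + (L i (z r' - z r) - L' (z r' - z r)) := by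
      rw [map_sub, map_sub]; abel
    have b : ‖L i (z r' - z r) - L' (z r' - z r)‖ ≤ k * ‖z r' - z r‖ := by
      have b1 := (L i).le_opNorm (z r' - z r)
      have b2 := L'.le_opNorm (z r' - z r)
      have b3 := norm_sub_le (L i (z r' - z r)) (L' (z r' - z r))
      have b4 : ‖L i‖ * ‖z r' - z r‖ ≤ |C| * ‖z r' - z r‖ := by
        gcongr; exact hi.trans (le_abs_self C)
      nlinarith [norm_nonneg (z r' - z r)]
    have b' : k * ‖z r' - z r‖ < δ / 2 := by
      calc k * ‖z r' - z r‖ < k * (δ / (2 * k)) := by gcongr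
        _ = δ / 2 := by field_simp
    rw [e]
    linarith [norm_add_le (L i (z r) - L' (z r)) (L i (z r' - z r) - L' (z r' - z r))]
  filter_upwards [Metric.tendstoUniformlyOn_iff.1 hu ε hε] with i hi r hr
  rw [← dist_eq_norm, dist_comm]
  exact hi r hr

end FunctionalAnalysis

section Discrete

variable {𝕜 E : Type*} [RCLike 𝕜] [NormedAddCommGroup E] [NormedSpace 𝕜 E]

theorem clm_mul_apply (S T : E →L[𝕜] E) (x : E) : (S * T) x = S (T x) := rfl

theorem norm_sub_sub_smul_le (w : ℕ → E) (c : E) {β : ℝ} {m : ℕ}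
    (h : ∀ k < m, ‖w (k + 1) - w k - c‖ ≤ β) : ‖w m - w 0 - m • c‖ ≤ m * β := by
  induction m with
  | zero => simp
  | succ m ih =>
    have h1 := ih fun k hk => h k (by omega)
    have e : w (m + 1) - w 0 - (m + 1) • c = (w m - w 0 - m • c) + (w (m + 1) - w m - c) := by
      rw [succ_nsmul]; abel
    rw [e]
    push_cast
    linarith [norm_add_le (w m - w 0 - m • c) (w (m + 1) - w m - c), h m (by omega)]

/-- Consistency errors of a discrete scheme with stable powers add up. -/
theorem norm_pow_apply_sub_le (P : E →L[𝕜] E) (X : ℕ → E) {C β : ℝ} {n : ℕ}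
    (hP : ∀ k ≤ n, ‖P ^ k‖ ≤ C) (hX : ∀ k < n, ‖P (X k) - X (k + 1)‖ ≤ β) :
    ‖(P ^ n) (X 0) - X n‖ ≤ n * (C * β) := by
  have hC : 0 ≤ C := (norm_nonneg _).trans (hP 0 (Nat.zero_le _))
  have key := norm_sub_sub_smul_le (fun k => (P ^ (n - k)) (X k)) 0 (β := C * β) (m := n) (by
    intro k hk
    have e : n - k = (n - (k + 1)) + 1 := by omega
    rw [sub_zero, e, pow_succ, clm_mul_apply, ← map_sub]
    calc ‖(P ^ (n - (k + 1))) (X (k + 1) - P (X k))‖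
        ≤ ‖P ^ (n - (k + 1))‖ * ‖X (k + 1) - P (X k)‖ := ContinuousLinearMap.le_opNorm _ _
      _ ≤ C * β := by
        rw [norm_sub_rev (X (k + 1))]
        exact mul_le_mul (hP _ (by omega)) (hX k hk) (norm_nonneg _) hC)
  simp only [Nat.sub_self, Nat.sub_zero, pow_zero, smul_zero, sub_zero] at key
  rw [norm_sub_rev]
  exact key

/-- The iterates of a vector move by at most a constant multiple of the first step. -/
theorem norm_pow_add_apply_sub_le (P : E →L[𝕜] E) (x : E) {C β : ℝ} {i m : ℕ}
    (hP : ∀ k ≤ i + m, ‖P ^ k‖ ≤ C) (hx : ‖P x - x‖ ≤ β) :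
    ‖(P ^ (i + m)) x - (P ^ i) x‖ ≤ m * (C * β) := by
  have hC : 0 ≤ C := (norm_nonneg _).trans (hP 0 (Nat.zero_le _))
  have key := norm_sub_sub_smul_le (fun k => (P ^ (i + k)) x) 0 (β := C * β) (m := m) (by
    intro k hk
    rw [sub_zero, ← add_assoc, pow_succ, clm_mul_apply, ← map_sub]
    exact ((P ^ (i + k)).le_opNorm _).trans
      (mul_le_mul (hP _ (by omega)) hx (norm_nonneg _) hC))
  simpa using key

/-- The resolvent of the difference quotient `(P - 1) / h`. -/
theorem exists_discrete_resolvent [CompleteSpace E] {P : E →L[𝕜] E} {a M h : ℝ} (ha : 0 ≤ a)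
    (hM : 1 ≤ M) (hh : 0 < h) (h1 : a * h ≤ 1) (h2 : a ^ 2 * h ≤ 1)
    (hP : ∀ m : ℕ, ‖P ^ m‖ ≤ M * Real.exp (a * h * m)) :
    ∃ Q : E →L[𝕜] E, ‖Q‖ ≤ M ∧
      (∀ x, P (Q x) = ((1 + (a + 2) * h : ℝ) : 𝕜) • Q x - (h : 𝕜) • x) ∧
      ∀ x, Q (P x) = ((1 + (a + 2) * h : ℝ) : 𝕜) • Q x - (h : 𝕜) • x := by
  set q : ℝ := 1 + (a + 2) * h with hq
  have hqpos : 0 < q := by positivity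
  have hexp : Real.exp (a * h) + h ≤ q := by
    have := Real.abs_exp_sub_one_sub_id_le (x := a * h) (by rwa [abs_of_nonneg (by positivity)])
    have h3 := (abs_le.1 this).2
    nlinarith
  set ρ : ℝ := Real.exp (a * h) / q with hρ
  have hρ0 : 0 ≤ ρ := by positivity
  have hρ1 : ρ < 1 := by rw [hρ, div_lt_one hqpos]; linarith
  set X : E →L[𝕜] E := ((q⁻¹ : ℝ) : 𝕜) • P with hX
  have hqne : (q : 𝕜) ≠ 0 := by exact_mod_cast hqpos.ne'
  have hXm : ∀ m : ℕ, ‖X ^ m‖ ≤ M * ρ ^ m := by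
    intro m
    rw [hX, smul_pow, norm_smul, norm_pow, RCLike.norm_ofReal, abs_of_pos (by positivity), hρ,
      div_pow, ← Real.exp_nat_mul]
    have := hP m
    rw [mul_comm (a * h)] at this
    calc q⁻¹ ^ m * ‖P ^ m‖ ≤ q⁻¹ ^ m * (M * Real.exp (m * (a * h))) := by gcongr
      _ = _ := by rw [inv_pow]; field_simp
  have hgeo : Summable fun m : ℕ => M * ρ ^ m :=
    (summable_geometric_of_lt_one hρ0 hρ1).mul_left M
  have hsum : Summable fun m : ℕ => X ^ m := Summable.of_norm_bounded hgeo hXm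
  set Y : E →L[𝕜] E := ∑' m : ℕ, X ^ m with hY
  have hYn : ‖Y‖ ≤ M * (1 - ρ)⁻¹ := by
    have := tsum_of_norm_bounded (hgeo.hasSum) hXm
    rwa [tsum_mul_left, tsum_geometric_of_lt_one hρ0 hρ1] at this
  have e1 : (1 - X) * Y = 1 := hsum.one_sub_mul_tsum_pow
  have e2 : Y * (1 - X) = 1 := hsum.tsum_pow_mul_one_sub
  have hPX : P = (q : 𝕜) • X := by
    rw [hX, smul_smul, RCLike.ofReal_inv, mul_inv_cancel₀ hqne, one_smul]
  have hqh : (q : 𝕜) * ((h / q : ℝ) : 𝕜) = (h : 𝕜) := by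
    rw [RCLike.ofReal_div]; field_simp
  refine ⟨((h / q : ℝ) : 𝕜) • Y, ?_, fun x => ?_, fun x => ?_⟩
  · rw [norm_smul, RCLike.norm_ofReal, abs_of_pos (by positivity)]
    calc h / q * ‖Y‖ ≤ h / q * (M * (1 - ρ)⁻¹) := by gcongr
      _ = M * (h / (q - Real.exp (a * h))) := by
        have : q - Real.exp (a * h) ≠ 0 := by linarith
        have : 1 - ρ = (q - Real.exp (a * h)) / q := by rw [hρ]; field_simp
        rw [this]; field_simp
      _ ≤ M * 1 := by
        gcongr
        rw [div_le_one (by linarith)]; linarith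
      _ = M := mul_one M
  · have h3 : Y x - X (Y x) = x := by
      have := congrArg (fun T : E →L[𝕜] E => T x) e1
      simpa using this
    have h4 : X (Y x) = Y x - x := by
      rw [eq_sub_iff_add_eq]
      nth_rewrite 2 [← h3]
      abel
    rw [hPX]
    simp only [smul_apply, map_smul, h4, smul_sub, smul_smul, ← hqh]
    rw [mul_comm]
  · have h3 : Y x - Y (X x) = x := by
      have := congrArg (fun T : E →L[𝕜] E => T x) e2
      simpa using this
    have h4 : Y (X x) = Y x - x := by
      rw [eq_sub_iff_add_eq]
      nth_rewrite 2 [← h3]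
      abel
    rw [hPX]
    simp only [smul_apply, map_smul, h4, smul_sub, smul_smul, ← hqh]

end Discrete

section Resolvent

variable {𝕜 E : Type*} [RCLike 𝕜] [NormedAddCommGroup E] [NormedSpace 𝕜 E]

/-- Stability of a family of operators, with explicit constants. -/
structure IsStable (F : ℝ≥0 → E →L[𝕜] E) (a M : ℝ) : Prop where
  nonneg : 0 ≤ a
  one_le : 1 ≤ M
  pow_le : ∀ (h : ℝ≥0) (m : ℕ), ‖F h ^ m‖ ≤ M * Real.exp (a * h * m)

theorem IsStable.pow_le_of_le {F : ℝ≥0 → E →L[𝕜] E} {a M : ℝ} (hF : IsStable F a M) {h : ℝ≥0}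
    {m : ℕ} {S : ℝ} (hS : h * m ≤ S) : ‖F h ^ m‖ ≤ M * Real.exp (a * S) := by
  refine (hF.pow_le h m).trans ?_
  have := hF.one_le
  have := hF.nonneg
  rw [mul_assoc]
  gcongr

theorem Conditions.exists_isStable {Z : E →ₗ.[𝕜] E} {t : ℝ≥0} {F : ℝ≥0 → E →L[𝕜] E}
    (hc : Conditions Z t F) : ∃ a M : ℝ, IsStable F a M := by
  obtain ⟨a, M, hM, h⟩ := hc.stable
  refine ⟨max a 0, M, le_max_right _ _, hM, fun s m => ?_⟩
  rcases Nat.eq_zero_or_pos m with rfl | hm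
  · rw [pow_zero]
    refine (ContinuousLinearMap.norm_id_le (𝕜 := 𝕜) (E := E)).trans ?_
    simpa using hM
  · have := h 1 m le_rfl hm s
    simp only [Nat.cast_one, div_one] at this
    refine this.trans ?_
    gcongr
    exact le_max_left _ _

/-- `R` is the strong limit, as `h → 0`, of the resolvents `Q h` of `(F h - 1) / h` at the
point `a + 2`. -/
structure IsResolventLimit (F Q : ℝ≥0 → E →L[𝕜] E) (R : E →L[𝕜] E) (a M : ℝ) : Prop where
  norm_le : ∀ᶠ h in 𝓝[>] (0 : ℝ≥0), ‖Q h‖ ≤ M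
  apply_apply : ∀ᶠ h in 𝓝[>] (0 : ℝ≥0), ∀ x,
    F h (Q h x) = ((1 + (a + 2) * h : ℝ) : 𝕜) • Q h x - ((h : ℝ) : 𝕜) • x
  tendsto : ∀ x, Tendsto (fun h => Q h x) (𝓝[>] 0) (𝓝 (R x))

theorem mem_graph_derivAtZero {F : ℝ≥0 → E →L[𝕜] E} {x y : E} :
    (x, y) ∈ (derivAtZero F).graph ↔
      Tendsto (fun h : ℝ≥0 => (((h : ℝ) : 𝕜))⁻¹ • (F h x - F 0 x)) (𝓝[>] 0) (𝓝 y) := by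
  rw [LinearPMap.mem_graph_iff]
  constructor
  · rintro ⟨ψ, h1, h2⟩
    have := derivAtZero_tendsto F ψ
    rwa [h1, h2] at this
  · intro h
    refine ⟨⟨x, y, h⟩, rfl, ?_⟩
    exact tendsto_nhds_unique (derivAtZero_tendsto F ⟨x, y, h⟩) h

theorem tendsto_of_le_derivAtZero {F : ℝ≥0 → E →L[𝕜] E} (hF0 : F 0 = 1) {Z : E →ₗ.[𝕜] E}
    (hZ : Z ≤ derivAtZero F) (x : Z.domain) :
    Tendsto (fun h : ℝ≥0 => (((h : ℝ) : 𝕜))⁻¹ • (F h x - x)) (𝓝[>] 0) (𝓝 (Z x)) := by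
  have h1 : ((x : E), Z x) ∈ (derivAtZero F).graph := LinearPMap.le_graph_of_le hZ (Z.mem_graph x)
  simpa [hF0] using mem_graph_derivAtZero.1 h1

theorem exists_resolvent_limit [CompleteSpace E] {F : ℝ≥0 → E →L[𝕜] E} {a M : ℝ}
    (hF : IsStable F a M) {Z : E →ₗ.[𝕜] E}
    (hZ : ∀ x : Z.domain, Tendsto (fun h : ℝ≥0 => (((h : ℝ) : 𝕜))⁻¹ • (F h x - x)) (𝓝[>] 0)
      (𝓝 (Z x)))
    (hd : Dense (Set.range fun x : Z.domain => ((a + 2 : ℝ) : 𝕜) • (x : E) - Z x)) :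
    ∃ (Q : ℝ≥0 → E →L[𝕜] E) (R : E →L[𝕜] E), IsResolventLimit F Q R a M ∧
      ∀ x : Z.domain, R (((a + 2 : ℝ) : 𝕜) • (x : E) - Z x) = x := by
  have hsmall : ∀ᶠ h : ℝ≥0 in 𝓝[>] (0 : ℝ≥0), 0 < h ∧ a * h ≤ 1 ∧ a ^ 2 * h ≤ 1 := by
    have h1 : Tendsto (fun h : ℝ≥0 => a * (h : ℝ)) (𝓝[>] 0) (𝓝 0) := by
      have : Continuous fun h : ℝ≥0 => a * (h : ℝ) := by fun_prop
      simpa using (this.tendsto 0).mono_left nhdsWithin_le_nhds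
    have h2 : Tendsto (fun h : ℝ≥0 => a ^ 2 * (h : ℝ)) (𝓝[>] 0) (𝓝 0) := by
      have : Continuous fun h : ℝ≥0 => a ^ 2 * (h : ℝ) := by fun_prop
      simpa using (this.tendsto 0).mono_left nhdsWithin_le_nhds
    filter_upwards [self_mem_nhdsWithin, h1.eventually (eventually_le_nhds zero_lt_one),
      h2.eventually (eventually_le_nhds zero_lt_one)] with h h3 h4 h5
    exact ⟨h3, h4, h5⟩
  have hex : ∀ h : ℝ≥0, ∃ Q : E →L[𝕜] E, 0 < h ∧ a * h ≤ 1 ∧ a ^ 2 * h ≤ 1 → ‖Q‖ ≤ M ∧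
      (∀ x, F h (Q x) = ((1 + (a + 2) * h : ℝ) : 𝕜) • Q x - ((h : ℝ) : 𝕜) • x) ∧
      ∀ x, Q (F h x) = ((1 + (a + 2) * h : ℝ) : 𝕜) • Q x - ((h : ℝ) : 𝕜) • x := by
    intro h
    by_cases hh : 0 < h ∧ a * h ≤ 1 ∧ a ^ 2 * h ≤ 1
    · obtain ⟨Q, hQ⟩ := exists_discrete_resolvent (P := F h) (h := h) hF.nonneg hF.one_le
        (by exact_mod_cast hh.1) hh.2.1 hh.2.2 (hF.pow_le h)
      exact ⟨Q, fun _ => hQ⟩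
    · exact ⟨0, fun h' => absurd h' hh⟩
  choose Q hQ using hex
  have hQn : ∀ᶠ h in 𝓝[>] (0 : ℝ≥0), ‖Q h‖ ≤ M := by
    filter_upwards [hsmall] with h hh using (hQ h hh).1
  have hlim : ∀ x : Z.domain, Tendsto (fun h => Q h (((a + 2 : ℝ) : 𝕜) • (x : E) - Z x)) (𝓝[>] 0)
      (𝓝 (x : E)) := by
    intro x
    have h1 : Tendsto (fun h : ℝ≥0 => M * ‖(((h : ℝ) : 𝕜))⁻¹ • (F h x - x) - Z x‖) (𝓝[>] 0)
        (𝓝 0) := by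
      simpa using ((hZ x).sub_const (Z x)).norm.const_mul M
    rw [tendsto_iff_norm_sub_tendsto_zero]
    refine squeeze_zero' (Eventually.of_forall fun h => norm_nonneg _) ?_ h1
    filter_upwards [hsmall] with h hh
    have hne : ((h : ℝ) : 𝕜) ≠ 0 := by exact_mod_cast hh.1.ne'
    have e : Q h (((a + 2 : ℝ) : 𝕜) • (x : E) - Z x) - x =
        Q h ((((h : ℝ) : 𝕜))⁻¹ • (F h x - x) - Z x) := by
      have e1 : (x : E) = (((h : ℝ) : 𝕜))⁻¹ • (((1 + (a + 2) * h : ℝ) : 𝕜) • Q h x - Q h (F h x)) := by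
        rw [(hQ h hh).2.2, sub_sub_cancel, smul_smul, inv_mul_cancel₀ hne, one_smul]
      nth_rewrite 2 [e1]
      simp only [map_sub, map_smul, smul_sub, smul_smul]
      have e2 : (((h : ℝ) : 𝕜))⁻¹ * ((1 + (a + 2) * h : ℝ) : 𝕜) =
          (((h : ℝ) : 𝕜))⁻¹ + ((a + 2 : ℝ) : 𝕜) := by
        push_cast
        field_simp
      rw [e2, add_smul]
      abel
    rw [e]
    refine ((Q h).le_opNorm _).trans ?_
    gcongr
    exact (hQ h hh).1
  have : (𝓝[>] (0 : ℝ≥0)).NeBot := inferInstance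
  obtain ⟨R, hR⟩ := exists_strong_limit hQn hd (by
    rintro _ ⟨x, rfl⟩
    exact ⟨x, hlim x⟩)
  exact ⟨Q, R, ⟨hQn, by filter_upwards [hsmall] with h hh using (hQ h hh).2.1, hR⟩,
    fun x => tendsto_nhds_unique (hR _) (hlim x)⟩

theorem tendsto_div_nat_nhdsGT {S : ℝ≥0} (hS : 0 < S) :
    Tendsto (fun n : ℕ => S / n) atTop (𝓝[>] 0) := by
  refine tendsto_nhdsWithin_iff.2 ⟨?_, ?_⟩
  · exact tendsto_const_div_atTop_nhds_zero_nat S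
  · filter_upwards [eventually_gt_atTop 0] with n hn
    have : (0 : ℝ≥0) < n := by exact_mod_cast hn
    exact div_pos hS this

section Mild

variable [NormedSpace ℝ E] [IsScalarTower ℝ 𝕜 E]

/-- `z` is a continuous mild solution of `z' = A z`, where `R = (a + 2 - A)⁻¹`. -/
structure IsMild (R : E →L[𝕜] E) (a : ℝ) (z : ℝ → E) : Prop where
  continuous : Continuous z
  hasDeriv : ∀ s : ℝ, 0 ≤ s →
    HasDerivWithinAt (fun r => R (z r)) ((a + 2) • R (z s) - z s) (Set.Ici s) s

/-- Mild solutions are the limits of the discrete approximations. -/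
theorem IsMild.tendsto_pow {F Q : ℝ≥0 → E →L[𝕜] E} {R : E →L[𝕜] E} {a M : ℝ}
    (hF : IsStable F a M) (hR : IsResolventLimit F Q R a M) {z : ℝ → E} (hz : IsMild R a z)
    {S : ℝ≥0} (hS : 0 < S) :
    Tendsto (fun n : ℕ => (F (S / n) ^ n) (R (R (z 0)))) atTop (𝓝 (R (R (z S)))) := by
  have hM := hF.one_le
  have ha := hF.nonneg
  set C : ℝ := M * Real.exp (a * S) with hC
  have hCpos : 0 < C := by positivity
  have hSpos : (0 : ℝ) < S := by exact_mod_cast hS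
  have hstep := tendsto_div_nat_nhdsGT hS
  set w : ℝ → E := fun r => (a + 2) • R (z r) - z r with hw
  have hwc : Continuous w := by have := hz.continuous; fun_prop
  have hpow : ∀ n : ℕ, 0 < n → ∀ k ≤ n, ‖F (S / n) ^ k‖ ≤ C := by
    intro n hn k hk
    refine hF.pow_le_of_le ?_
    have hn' : (0 : ℝ) < n := by exact_mod_cast hn
    have hk' : (k : ℝ) ≤ n := by exact_mod_cast hk
    push_cast
    rw [div_mul_eq_mul_div, div_le_iff₀ hn']
    gcongr
  have hscheme : Tendsto (fun n : ℕ => (F (S / n) ^ n) (Q (S / n) (R (z 0))) -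
      Q (S / n) (R (z S))) atTop (𝓝 0) := by
    rw [Metric.tendsto_nhds]
    intro ε' hε'
    set ε : ℝ := ε' / (2 * S * C * (1 + M)) with hε
    have hεpos : 0 < ε := by positivity
    have huc := isCompact_Icc.uniformContinuousOn_of_continuous
      (hwc.continuousOn (s := Set.Icc 0 (S : ℝ)))
    obtain ⟨δ, hδ, hmod⟩ := Metric.uniformContinuousOn_iff.1 huc ε hεpos
    have hδ' : ∀ᶠ n : ℕ in atTop, ((S / n : ℝ≥0) : ℝ) < δ := by
      have h0 : Tendsto (fun n : ℕ => ((S / n : ℝ≥0) : ℝ)) atTop (𝓝 0) := by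
        exact_mod_cast (NNReal.continuous_coe.tendsto 0).comp (tendsto_nhds_of_tendsto_nhdsWithin hstep)
      exact h0.eventually (gt_mem_nhds hδ)
    filter_upwards [hδ', eventually_gt_atTop 0, hstep.eventually hR.norm_le,
      hstep.eventually hR.apply_apply,
      hstep.eventually (eventually_forall_image_lt (isCompact_Icc (a := (0 : ℝ)) (b := S))
        hz.continuous hR.norm_le hR.tendsto hεpos)] with n hnδ hn hQn hFQ hunif
    have hn' : (0 : ℝ) < n := by exact_mod_cast hn
    set h : ℝ≥0 := S / n with hh
    have hnh : (n : ℝ) * h = S := by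
      rw [hh]; push_cast; field_simp
    have hhpos : (0 : ℝ) < h := by rw [hh]; push_cast; positivity
    have key := norm_pow_apply_sub_le (F h) (fun k => Q h (R (z (k * h)))) (C := C)
      (β := h * (ε * (1 + M))) (n := n) (hpow n hn) (by
        intro k hk
        have hk' : (k : ℝ) + 1 ≤ n := by exact_mod_cast hk
        have hk0 : (0 : ℝ) ≤ k := Nat.cast_nonneg k
        have hkh : (k + 1) * (h : ℝ) ≤ S := by rw [← hnh]; gcongr
        have hkh0 : (0 : ℝ) ≤ k * h := by positivity
        have hmem : (k : ℝ) * h ∈ Set.Icc 0 (S : ℝ) := ⟨hkh0, by nlinarith⟩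
        have hinc : ‖(R (z ((k + 1) * h)) - ((k + 1) * h : ℝ) • w (k * h)) -
            (R (z (k * h)) - (k * h : ℝ) • w (k * h))‖ ≤ ε * ((k + 1) * h - k * h) := by
          refine norm_image_sub_le_of_norm_deriv_right_le_segment
            (f := fun r : ℝ => R (z r) - r • w (k * h)) (f' := fun r => w r - w (k * h))
            (a := k * h) (b := (k + 1) * h) ?_ ?_ ?_ _ ⟨by nlinarith, le_rfl⟩
          · have := hz.continuous
            fun_prop
          · intro r hr
            have h1 := hz.hasDeriv r (hkh0.trans hr.1)
            have h2 : HasDerivWithinAt (fun r : ℝ => r • w (k * h)) ((1 : ℝ) • w (k * h))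
              (Set.Ici r) r := (hasDerivWithinAt_id r _).smul_const _
            rw [one_smul] at h2
            exact h1.sub h2
          · intro r hr
            rw [← dist_eq_norm]
            refine (hmod r ⟨hkh0.trans hr.1, hr.2.le.trans hkh⟩ _ hmem ?_).le
            rw [Real.dist_eq, abs_of_nonneg (by linarith [hr.1])]
            have := hr.2
            nlinarith
        set e := (R (z ((k + 1) * h)) - ((k + 1) * h : ℝ) • w (k * h)) -
            (R (z (k * h)) - (k * h : ℝ) • w (k * h)) with he
        have e1 : R (z ((k + 1) * h)) = R (z (k * h)) + (h : ℝ) • w (k * h) + e := by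
          rw [he, add_mul, one_mul, add_smul]; abel
        have e2 : F h (Q h (R (z (k * h)))) - Q h (R (z ((k + 1) * h))) =
            (h : ℝ) • (Q h (z (k * h)) - R (z (k * h))) - Q h e := by
          rw [e1, hFQ, hw]
          simp only [RCLike.real_smul_eq_coe_smul (K := 𝕜), map_add, map_sub, map_smul, smul_sub,
            smul_smul]
          push_cast
          rw [add_smul, one_smul, mul_comm ((h : ℝ) : 𝕜)]
          abel
        push_cast
        rw [e2]
        have b1 := hunif _ hmem
        have b2 : ‖Q h e‖ ≤ M * (ε * h) := by
          refine ((Q h).le_opNorm e).trans (mul_le_mul hQn ?_ (norm_nonneg _) (by linarith))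
          exact hinc.trans (le_of_eq (by ring))
        have b3 : ‖(h : ℝ) • (Q h (z (k * h)) - R (z (k * h)))‖ ≤ h * ε := by
          rw [norm_smul, Real.norm_of_nonneg hhpos.le]
          gcongr
        calc _ ≤ _ := norm_sub_le _ _
          _ ≤ h * ε + M * (ε * h) := add_le_add b3 b2
          _ = _ := by ring)
    simp only [Nat.cast_zero, zero_mul, hnh] at key
    rw [dist_zero_right]
    calc _ ≤ _ := key
      _ = (n * h) * C * (1 + M) * ε := by ring
      _ = ε' / 2 := by rw [hnh, hε]; field_simp
      _ < ε' := by linarith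
  have hlim : ∀ x, Tendsto (fun n : ℕ => Q (S / n) x) atTop (𝓝 (R x)) := fun x =>
    (hR.tendsto x).comp hstep
  have hinit : Tendsto (fun n : ℕ => (F (S / n) ^ n) (R (R (z 0)) - Q (S / n) (R (z 0)))) atTop
      (𝓝 0) := by
    have h1 : Tendsto (fun n : ℕ => C * ‖R (R (z 0)) - Q (S / n) (R (z 0))‖) atTop (𝓝 0) := by
      simpa using ((hlim (R (z 0))).const_sub (R (R (z 0)))).norm.const_mul C
    refine squeeze_zero_norm' ?_ h1
    filter_upwards [eventually_gt_atTop 0] with n hn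
    refine (ContinuousLinearMap.le_opNorm _ _).trans ?_
    gcongr
    exact hpow n hn n le_rfl
  have := (hinit.add hscheme).add (hlim (R (z S)))
  simp only [zero_add] at this
  refine this.congr fun n => ?_
  rw [map_sub]
  abel

/-- A mild solution is determined by its initial value. -/
theorem IsMild.unique {F Q : ℝ≥0 → E →L[𝕜] E} {R : E →L[𝕜] E} {a M : ℝ}
    (hF : IsStable F a M) (hR : IsResolventLimit F Q R a M) (hinj : ∀ x, R x = 0 → x = 0)
    {z z' : ℝ → E} (hz : IsMild R a z) (hz' : IsMild R a z') (h0 : z 0 = z' 0) (s : ℝ≥0) :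
    z s = z' s := by
  rcases eq_or_lt_of_le (zero_le (a := s)) with rfl | hs
  · simpa using h0
  · have h1 := hz.tendsto_pow hF hR hs
    rw [h0] at h1
    have h2 := tendsto_nhds_unique h1 (hz'.tendsto_pow hF hR hs)
    rw [← sub_eq_zero] at h2 ⊢
    refine hinj _ (hinj _ ?_)
    rw [map_sub, map_sub, h2]

end Mild

end Resolvent

section WeakLimit

variable {𝕜 E : Type*} [RCLike 𝕜] [NormedAddCommGroup E] [NormedSpace 𝕜 E]

theorem norm_le_of_weak_limit {ι : Type*} {l : Filter ι} [l.NeBot] {x : ι → E} {y : E}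
    (hx : ∀ φ : StrongDual 𝕜 E, Tendsto (fun n => φ (x n)) l (𝓝 (φ y))) {c : ι → ℝ} {C : ℝ}
    (hb : ∀ᶠ n in l, ‖x n‖ ≤ c n) (hc : Tendsto c l (𝓝 C)) : ‖y‖ ≤ C := by
  have hC : 0 ≤ C := ge_of_tendsto hc (hb.mono fun n hn => (norm_nonneg _).trans hn)
  refine NormedSpace.norm_le_dual_bound 𝕜 y hC fun φ => ?_
  refine le_of_tendsto_of_tendsto (hx φ).norm (hc.mul_const ‖φ‖) ?_
  filter_upwards [hb] with n hn
  rw [mul_comm]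
  exact (φ.le_opNorm _).trans (by gcongr)

theorem step_mul_floor_le (t s : ℝ≥0) (n : ℕ) :
    ((t / n : ℝ≥0) : ℝ) * ⌊(n : ℝ≥0) * (s / t)⌋₊ ≤ s := by
  have h : (t / n) * (⌊(n : ℝ≥0) * (s / t)⌋₊ : ℝ≥0) ≤ s := by
    calc (t / n) * (⌊(n : ℝ≥0) * (s / t)⌋₊ : ℝ≥0) ≤ (t / n) * ((n : ℝ≥0) * (s / t)) := by
          gcongr; exact Nat.floor_le zero_le
      _ ≤ s := by
        rcases eq_or_ne (n : ℝ≥0) 0 with hn | hn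
        · simp [hn]
        rcases eq_or_ne t 0 with rfl | ht
        · simp
        · rw [← mul_assoc, div_mul_cancel₀ _ hn, mul_div_cancel₀ _ ht]
  exact_mod_cast h

theorem tendsto_step_mul_floor {t : ℝ≥0} (ht : 0 < t) (s : ℝ≥0) :
    Tendsto (fun n : ℕ => ((t / n : ℝ≥0) : ℝ) * ⌊(n : ℝ≥0) * (s / t)⌋₊) atTop (𝓝 (s : ℝ)) := by
  have h0 : Tendsto (fun n : ℕ => (s : ℝ) - ((t / n : ℝ≥0) : ℝ)) atTop (𝓝 (s - 0)) :=
    ((NNReal.continuous_coe.tendsto 0).comp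
      (tendsto_nhds_of_tendsto_nhdsWithin (tendsto_div_nat_nhdsGT ht))).const_sub _
  rw [sub_zero] at h0
  refine tendsto_of_tendsto_of_tendsto_of_le_of_le' h0 tendsto_const_nhds ?_
    (Eventually.of_forall fun n => step_mul_floor_le t s n)
  filter_upwards [eventually_gt_atTop 0] with n hn
  have hn' : (n : ℝ≥0) ≠ 0 := by exact_mod_cast hn.ne'
  have h1 : (n : ℝ≥0) * (s / t) ≤ ⌊(n : ℝ≥0) * (s / t)⌋₊ + 1 := (Nat.lt_floor_add_one _).le
  have h2 : s ≤ (t / n) * (⌊(n : ℝ≥0) * (s / t)⌋₊ + 1) := by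
    calc s = (t / n) * ((n : ℝ≥0) * (s / t)) := by
          rw [← mul_assoc, div_mul_cancel₀ _ hn', mul_div_cancel₀ _ ht.ne']
      _ ≤ _ := by gcongr
  have h3 : (s : ℝ) ≤ ((t / n : ℝ≥0) : ℝ) * (⌊(n : ℝ≥0) * (s / t)⌋₊ + 1) := by exact_mod_cast h2
  linarith

/-- `T s` is the weak limit, along a fixed free ultrafilter, of `F (t / n) ^ ⌊n s / t⌋`. -/
def IsWeakLimit (F : ℝ≥0 → E →L[𝕜] E) (t : ℝ≥0) (T : ℝ≥0 → E →L[𝕜] E) : Prop :=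
  ∀ (s : ℝ≥0) (f : E) (φ : StrongDual 𝕜 E),
    Tendsto (fun n : ℕ => φ ((F (t / n) ^ ⌊(n : ℝ≥0) * (s / t)⌋₊) f)) (hyperfilter ℕ)
      (𝓝 (φ (T s f)))

theorem norm_pow_floor_apply_le {F : ℝ≥0 → E →L[𝕜] E} {a M : ℝ} (hF : IsStable F a M)
    (t s : ℝ≥0) (n : ℕ) (f : E) :
    ‖(F (t / n) ^ ⌊(n : ℝ≥0) * (s / t)⌋₊) f‖ ≤ M * Real.exp (a * s) * ‖f‖ :=
  (ContinuousLinearMap.le_opNorm _ _).trans (by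
    gcongr
    exact hF.pow_le_of_le (step_mul_floor_le t s n))

theorem exists_isWeakLimit (hE : IsReflexiveSpace 𝕜 E) {F : ℝ≥0 → E →L[𝕜] E} {a M : ℝ}
    (hF : IsStable F a M) (t : ℝ≥0) : ∃ T : ℝ≥0 → E →L[𝕜] E, IsWeakLimit F t T := by
  have hb := norm_pow_floor_apply_le hF t
  choose T hT using fun s f => exists_weak_limit hE (hyperfilter ℕ)
    (Eventually.of_forall fun n => hb s n f)
  refine ⟨fun s => LinearMap.mkContinuous
    { toFun := T s
      map_add' := fun f g => eq_of_forall_dual_eq (𝕜 := 𝕜) fun φ => ?_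
      map_smul' := fun c f => eq_of_forall_dual_eq (𝕜 := 𝕜) fun φ => ?_ } (M * Real.exp (a * s))
      fun f => norm_le_of_weak_limit (hT s f) (Eventually.of_forall fun n => hb s n f)
        tendsto_const_nhds, fun s f φ => hT s f φ⟩
  · refine tendsto_nhds_unique (hT s (f + g) φ) ?_
    simpa using (hT s f φ).add (hT s g φ)
  · refine tendsto_nhds_unique (hT s (c • f) φ) ?_
    simpa using (hT s f φ).const_mul c

theorem IsWeakLimit.norm_le {F T : ℝ≥0 → E →L[𝕜] E} {a M : ℝ} {t : ℝ≥0} (hT : IsWeakLimit F t T)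
    (hF : IsStable F a M) (s : ℝ≥0) : ‖T s‖ ≤ M * Real.exp (a * s) := by
  have := hF.one_le
  exact ContinuousLinearMap.opNorm_le_bound _ (by positivity) fun f =>
    norm_le_of_weak_limit (hT s f)
      (Eventually.of_forall fun n => norm_pow_floor_apply_le hF t s n f) tendsto_const_nhds

theorem IsWeakLimit.map_zero {F T : ℝ≥0 → E →L[𝕜] E} {t : ℝ≥0} (hT : IsWeakLimit F t T) :
    T 0 = 1 := by
  ext f
  refine eq_of_forall_dual_eq (𝕜 := 𝕜) fun φ => ?_
  have := hT 0 f φ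
  simp only [zero_div, mul_zero, Nat.floor_zero, pow_zero] at this
  exact tendsto_nhds_unique this tendsto_const_nhds

theorem eventually_norm_sub_le {F : ℝ≥0 → E →L[𝕜] E} {x y : E}
    (h : Tendsto (fun h : ℝ≥0 => (((h : ℝ) : 𝕜))⁻¹ • (F h x - x)) (𝓝[>] 0) (𝓝 y)) :
    ∀ᶠ h in 𝓝[>] (0 : ℝ≥0), ‖F h x - x‖ ≤ h * (‖y‖ + 1) := by
  filter_upwards [h.norm.eventually (gt_mem_nhds (lt_add_one ‖y‖)), self_mem_nhdsWithin]
    with r hr hr0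
  have hr0' : (0 : ℝ) < r := by exact_mod_cast hr0
  rw [norm_smul, norm_inv, RCLike.norm_ofReal, abs_of_pos hr0', inv_mul_lt_iff₀ hr0'] at hr
  exact hr.le

variable {F : ℝ≥0 → E →L[𝕜] E} {a M : ℝ} {t : ℝ≥0}

/-- Along the discrete scheme, vectors with a bounded difference quotient move at bounded speed. -/
theorem eventually_norm_pow_sub_le (hF : IsStable F a M) (ht : 0 < t) {x y : E}
    (h : Tendsto (fun h : ℝ≥0 => (((h : ℝ) : 𝕜))⁻¹ • (F h x - x)) (𝓝[>] 0) (𝓝 y)) (S : ℝ) :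
    ∀ᶠ n : ℕ in atTop, ∀ i m : ℕ, ((t / n : ℝ≥0) : ℝ) * (i + m : ℕ) ≤ S →
      ‖(F (t / n) ^ (i + m)) x - (F (t / n) ^ i) x‖ ≤
        (((t / n : ℝ≥0) : ℝ) * m) * (M * Real.exp (a * S) * (‖y‖ + 1)) := by
  filter_upwards [(tendsto_div_nat_nhdsGT ht).eventually (eventually_norm_sub_le h)]
    with n hn i m him
  refine (norm_pow_add_apply_sub_le (F (t / n)) x (C := M * Real.exp (a * S)) (fun k hk =>
    hF.pow_le_of_le (le_trans (by gcongr) him)) hn).trans (le_of_eq (by ring))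

theorem floor_add_sub {r s : ℝ≥0} (hrs : r ≤ s) (n : ℕ) :
    ⌊(n : ℝ≥0) * (r / t)⌋₊ + (⌊(n : ℝ≥0) * (s / t)⌋₊ - ⌊(n : ℝ≥0) * (r / t)⌋₊) =
      ⌊(n : ℝ≥0) * (s / t)⌋₊ :=
  Nat.add_sub_cancel' (Nat.floor_mono (by gcongr))

theorem tendsto_step_mul_floor_sub (ht : 0 < t) {r s : ℝ≥0} (hrs : r ≤ s) :
    Tendsto (fun n : ℕ => ((t / n : ℝ≥0) : ℝ) *
      (⌊(n : ℝ≥0) * (s / t)⌋₊ - ⌊(n : ℝ≥0) * (r / t)⌋₊ : ℕ)) atTop (𝓝 ((s : ℝ) - r)) := by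
  refine ((tendsto_step_mul_floor ht s).sub (tendsto_step_mul_floor ht r)).congr fun n => ?_
  rw [Nat.cast_sub (Nat.floor_mono (by gcongr)), mul_sub]

variable {T : ℝ≥0 → E →L[𝕜] E}

theorem IsWeakLimit.norm_sub_le (hT : IsWeakLimit F t T) (hF : IsStable F a M) (ht : 0 < t)
    {x y : E} (h : Tendsto (fun h : ℝ≥0 => (((h : ℝ) : 𝕜))⁻¹ • (F h x - x)) (𝓝[>] 0) (𝓝 y))
    {r s : ℝ≥0} {S : ℝ} (hrs : r ≤ s) (hS : s ≤ S) :
    ‖T s x - T r x‖ ≤ (s - r) * (M * Real.exp (a * S) * (‖y‖ + 1)) := by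
  refine norm_le_of_weak_limit (𝕜 := 𝕜) (l := hyperfilter ℕ) (x := fun n : ℕ =>
    (F (t / n) ^ ⌊(n : ℝ≥0) * (s / t)⌋₊) x - (F (t / n) ^ ⌊(n : ℝ≥0) * (r / t)⌋₊) x)
    (fun φ => ?_) ?_ (((tendsto_step_mul_floor_sub ht hrs).mono_left
      Nat.hyperfilter_le_atTop).mul_const (M * Real.exp (a * S) * (‖y‖ + 1)))
  · simpa using (hT s x φ).sub (hT r x φ)
  · filter_upwards [(eventually_norm_pow_sub_le hF ht h S).filter_mono Nat.hyperfilter_le_atTop]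
      with n hn
    have := hn ⌊(n : ℝ≥0) * (r / t)⌋₊ (⌊(n : ℝ≥0) * (s / t)⌋₊ - ⌊(n : ℝ≥0) * (r / t)⌋₊)
    rw [floor_add_sub hrs] at this
    exact this ((step_mul_floor_le t s n).trans hS)

theorem dualFamily_apply (F : ℝ≥0 → E →L[𝕜] E) (h : ℝ≥0) (ψ : StrongDual 𝕜 E) (x : E) :
    dualFamily F h ψ x = ψ (F h x) := rfl

theorem tendsto_dualFamily (hF0 : F 0 = 1) (ψ : (derivAtZero (dualFamily F)).domain) :
    Tendsto (fun h : ℝ≥0 => (((h : ℝ) : 𝕜))⁻¹ • (dualFamily F h ψ - ψ)) (𝓝[>] 0)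
      (𝓝 (derivAtZero (dualFamily F) ψ)) := by
  have : dualFamily F 0 = 1 := by
    ext φ x
    simp [dualFamily_apply, hF0]
  simpa [this] using derivAtZero_tendsto (dualFamily F) ψ

theorem dual_apply_eq (hF0 : F 0 = 1) {x y : E}
    (h : Tendsto (fun h : ℝ≥0 => (((h : ℝ) : 𝕜))⁻¹ • (F h x - x)) (𝓝[>] 0) (𝓝 y))
    (ψ : (derivAtZero (dualFamily F)).domain) :
    (ψ : StrongDual 𝕜 E) y = derivAtZero (dualFamily F) ψ x := by
  have h1 := ((ψ : StrongDual 𝕜 E).continuous.tendsto y).comp h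
  have h2 := ((NormedSpace.inclusionInDoubleDual 𝕜 E x).continuous.tendsto _).comp
    (tendsto_dualFamily hF0 ψ)
  refine tendsto_nhds_unique h1 (h2.congr fun h => ?_)
  simp [dualFamily_apply]

/-- Tested against the domain of `(F^*)'(0)`, the weak limit is differentiable. -/
theorem IsWeakLimit.norm_dual_sub_le (hT : IsWeakLimit F t T) (hF : IsStable F a M)
    (hF0 : F 0 = 1) (ht : 0 < t) {x y : E}
    (h : Tendsto (fun h : ℝ≥0 => (((h : ℝ) : 𝕜))⁻¹ • (F h x - x)) (𝓝[>] 0) (𝓝 y))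
    (ψ : (derivAtZero (dualFamily F)).domain) {r s : ℝ≥0} {S : ℝ} (hrs : r ≤ s) (hS : s ≤ S) :
    ‖(ψ : StrongDual 𝕜 E) (T s x) - (ψ : StrongDual 𝕜 E) (T r x) -
        ((s - r : ℝ) : 𝕜) * derivAtZero (dualFamily F) ψ (T r x)‖ ≤
      (s - r) * (‖derivAtZero (dualFamily F) ψ‖ *
        ((s - r) * (M * Real.exp (a * S) * (‖y‖ + 1)))) := by
  set ψ' := derivAtZero (dualFamily F) ψ with hψ'
  set L := M * Real.exp (a * S) * (‖y‖ + 1) with hL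
  have hM := hF.one_le
  set m : ℕ → ℕ := fun n => ⌊(n : ℝ≥0) * (s / t)⌋₊ - ⌊(n : ℝ≥0) * (r / t)⌋₊ with hm
  have hmt := tendsto_step_mul_floor_sub ht hrs
  set δ : ℕ → ℝ := fun n =>
    ‖((((t / n : ℝ≥0) : ℝ) : 𝕜))⁻¹ • (dualFamily F (t / n) ψ - ψ) - ψ'‖ with hδ
  have hδ0 : Tendsto δ atTop (𝓝 0) := by
    have := (((tendsto_dualFamily hF0 ψ).comp (tendsto_div_nat_nhdsGT ht)).sub_const ψ').norm
    rwa [sub_self, norm_zero] at this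
  have hlhs := (((hT s x ψ).sub (hT r x ψ)).sub
    (((RCLike.continuous_ofReal (K := 𝕜)).tendsto _ |>.comp
      (hmt.mono_left Nat.hyperfilter_le_atTop)).mul (hT r x ψ'))).norm
  have hrhs := (hmt.mul ((hδ0.mul_const (M * Real.exp (a * S) * ‖x‖)).add
    ((hmt.mul_const L).const_mul ‖ψ'‖))).mono_left Nat.hyperfilter_le_atTop
  rw [zero_mul, zero_add] at hrhs
  refine le_of_tendsto_of_tendsto hlhs hrhs ?_
  have hev : ∀ᶠ n : ℕ in atTop, 0 < n := eventually_gt_atTop 0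
  filter_upwards [(eventually_norm_pow_sub_le hF ht h S).filter_mono Nat.hyperfilter_le_atTop,
    hev.filter_mono Nat.hyperfilter_le_atTop] with n hn hn0
  set k : ℝ≥0 := t / n with hk
  set i := ⌊(n : ℝ≥0) * (r / t)⌋₊ with hi
  have hkpos : (0 : ℝ) < k := by
    have : (0 : ℝ≥0) < n := by exact_mod_cast hn0
    exact_mod_cast div_pos ht this
  have hend : (k : ℝ) * (i + m n : ℕ) ≤ S := by
    rw [hi, hm, floor_add_sub hrs]
    exact (step_mul_floor_le t s n).trans hS
  have key := norm_sub_sub_smul_le (fun j => (ψ : StrongDual 𝕜 E) ((F k ^ (i + j)) x))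
    (((k : ℝ) : 𝕜) * ψ' ((F k ^ i) x)) (m := m n)
    (β := k * (δ n * (M * Real.exp (a * S) * ‖x‖) + ‖ψ'‖ * (k * m n * L))) (by
      intro j hj
      have hj' : (j : ℝ) ≤ m n := by exact_mod_cast hj.le
      have hij : (k : ℝ) * (i + j : ℕ) ≤ S := by
        refine le_trans ?_ hend
        gcongr
      have hkne : ((k : ℝ) : 𝕜) ≠ 0 := by exact_mod_cast hkpos.ne'
      set z := (F k ^ (i + j)) x with hz
      have e : (ψ : StrongDual 𝕜 E) ((F k ^ (i + (j + 1))) x) - (ψ : StrongDual 𝕜 E) z -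
          ((k : ℝ) : 𝕜) * ψ' ((F k ^ i) x) = ((k : ℝ) : 𝕜) *
          ((((k : ℝ) : 𝕜)⁻¹ • (dualFamily F k ψ - ψ) - ψ') z + ψ' (z - (F k ^ i) x)) := by
        rw [← add_assoc i j 1, pow_succ', clm_mul_apply, ← hz, map_sub]
        simp only [sub_apply, smul_apply, dualFamily_apply, smul_eq_mul]
        field_simp
        ring
      rw [e, norm_mul, RCLike.norm_ofReal, abs_of_pos hkpos]
      gcongr
      refine (norm_add_le _ _).trans (add_le_add ?_ ?_)
      · refine (ContinuousLinearMap.le_opNorm _ _).trans ?_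
        gcongr
        exact (ContinuousLinearMap.le_opNorm _ _).trans
          (by gcongr; exact hF.pow_le_of_le hij)
      · refine (ContinuousLinearMap.le_opNorm _ _).trans ?_
        gcongr
        refine (hn i j hij).trans ?_
        gcongr)
  have hfl : i + m n = ⌊(n : ℝ≥0) * (s / t)⌋₊ := floor_add_sub hrs n
  simp only [hfl, add_zero] at key
  have e2 : m n • (((k : ℝ) : 𝕜) * ψ' ((F k ^ i) x)) =
      ((k * m n : ℝ) : 𝕜) * ψ' ((F k ^ i) x) := by
    rw [nsmul_eq_mul]; push_cast; ring
  rw [e2] at key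
  refine key.trans (le_of_eq ?_)
  ring

end WeakLimit

section WeakSolution

variable {𝕜 E : Type*} [RCLike 𝕜] [NormedAddCommGroup E] [NormedSpace 𝕜 E]
variable {F T : ℝ≥0 → E →L[𝕜] E} {a M : ℝ} {t : ℝ≥0} {Z : E →ₗ.[𝕜] E}

/-- If the discrete scheme is approximated by vectors with bounded image under `Z`, then its weak
limit lies, in the weak sense, in the domain of the closure of `Z`. -/
theorem IsWeakLimit.exists_generator_value (hE : IsReflexiveSpace 𝕜 E) (hT : IsWeakLimit F t T)
    {f : E} {s : ℝ≥0} {g : ℕ → Z.domain}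
    (hg : Tendsto (fun n : ℕ => ‖(F (t / n) ^ ⌊(n : ℝ≥0) * (s / t)⌋₊) f - (g n : E)‖) atTop (𝓝 0))
    (hb : Bornology.IsBounded (Set.range fun n => Z (g n))) :
    ∃ v : E, ∀ Φ Ψ : StrongDual 𝕜 E, (∀ x : Z.domain, Φ (Z x) = Ψ x) → Φ v = Ψ (T s f) := by
  obtain ⟨C, hC⟩ := isBounded_iff_forall_norm_le.1 hb
  obtain ⟨v, hv⟩ := exists_weak_limit (𝕜 := 𝕜) hE (hyperfilter ℕ)
    (Eventually.of_forall fun n => hC _ ⟨n, rfl⟩)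
  refine ⟨v, fun Φ Ψ h => ?_⟩
  have h1 := (hT s f Ψ).sub ((Ψ.continuous.tendsto 0).comp
    ((tendsto_zero_iff_norm_tendsto_zero.2 hg).mono_left Nat.hyperfilter_le_atTop))
  rw [_root_.map_zero, sub_zero] at h1
  refine tendsto_nhds_unique (hv Φ) (h1.congr fun n => ?_)
  simp [h]

theorem IsWeakLimit.hasDerivWithinAt (hT : IsWeakLimit F t T) (hF : IsStable F a M)
    (hF0 : F 0 = 1) (ht : 0 < t)
    (hd : Dense ((derivAtZero (dualFamily F)).domain : Set (StrongDual 𝕜 E))) {x y : E}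
    (h : Tendsto (fun h : ℝ≥0 => (((h : ℝ) : 𝕜))⁻¹ • (F h x - x)) (𝓝[>] 0) (𝓝 y))
    {s : ℝ≥0} {v : E} (hv : ∀ ψ : (derivAtZero (dualFamily F)).domain,
      (ψ : StrongDual 𝕜 E) v = derivAtZero (dualFamily F) ψ (T s x)) (φ : StrongDual 𝕜 E) :
    HasDerivWithinAt (fun r : ℝ => φ (T r.toNNReal x)) (φ v) (Set.Ici (s : ℝ)) s := by
  have hM := hF.one_le
  rw [hasDerivWithinAt_iff_isLittleO, Asymptotics.isLittleO_iff]
  intro c hc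
  set L := M * Real.exp (a * (s + 1)) * (‖y‖ + 1) with hL
  have hL0 : 0 ≤ L := by positivity
  set κ := c / (2 * (L + ‖v‖ + 1)) with hκ
  have hκ0 : 0 < κ := by positivity
  obtain ⟨ψ, hψ, hφψ⟩ := Metric.mem_closure_iff.1 (hd φ) κ hκ0
  set ψ' := derivAtZero (dualFamily F) ⟨ψ, hψ⟩ with hψ'
  set η := min 1 (c / (2 * (‖ψ'‖ * L + 1))) with hη
  have hη0 : 0 < η := by positivity
  filter_upwards [self_mem_nhdsWithin,
    mem_nhdsWithin_of_mem_nhds (Iio_mem_nhds (lt_add_of_pos_right (s : ℝ) hη0))] with r hr hr'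
  have hsr : (s : ℝ) ≤ r := hr
  lift r to ℝ≥0 using s.2.trans hsr
  have hsr' : s ≤ r := by exact_mod_cast hsr
  have hrη : (r : ℝ) - s ≤ η := by
    have : (r : ℝ) < s + η := hr'
    linarith
  have hrs0 : (0 : ℝ) ≤ r - s := by linarith
  have hr1 : (r : ℝ) ≤ s + 1 := by linarith [min_le_left 1 (c / (2 * (‖ψ'‖ * L + 1)))]
  rw [Real.toNNReal_coe, Real.toNNReal_coe]
  have b1 := hT.norm_sub_le hF ht h hsr' hr1
  have b2 := hT.norm_dual_sub_le hF hF0 ht h ⟨ψ, hψ⟩ hsr' hr1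
  rw [← hL] at b1 b2
  rw [← hψ', ← hv ⟨ψ, hψ⟩] at b2
  change ‖ψ (T r x) - ψ (T s x) - ((r - s : ℝ) : 𝕜) * ψ v‖ ≤ _ at b2
  rw [dist_eq_norm] at hφψ
  have e : φ (T r x) - φ (T s x) - (r - s : ℝ) • φ v =
      (φ - ψ) (T r x - T s x) + (ψ (T r x) - ψ (T s x) - ((r - s : ℝ) : 𝕜) * ψ v) -
        ((r - s : ℝ) : 𝕜) * (φ - ψ) v := by
    rw [RCLike.real_smul_eq_coe_mul]
    simp only [sub_apply, map_sub]
    ring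
  have b3 : ‖(φ - ψ) (T r x - T s x)‖ ≤ κ * ((r - s) * L) :=
    (ContinuousLinearMap.le_opNorm _ _).trans (by gcongr)
  have b4 : ‖((r - s : ℝ) : 𝕜) * (φ - ψ) v‖ ≤ (r - s) * (κ * ‖v‖) := by
    rw [norm_mul, RCLike.norm_ofReal, abs_of_nonneg hrs0]
    gcongr
    exact (ContinuousLinearMap.le_opNorm _ _).trans (by gcongr)
  have b5 : ‖ψ'‖ * L * (r - s) ≤ c / 2 := by
    have : (r : ℝ) - s ≤ c / (2 * (‖ψ'‖ * L + 1)) := hrη.trans (min_le_right _ _)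
    calc ‖ψ'‖ * L * (r - s) ≤ (‖ψ'‖ * L + 1) * (c / (2 * (‖ψ'‖ * L + 1))) := by
          gcongr; linarith
      _ = c / 2 := by field_simp
  have b6 : κ * (L + ‖v‖) ≤ c / 2 := by
    calc κ * (L + ‖v‖) ≤ κ * (L + ‖v‖ + 1) :=
          mul_le_mul_of_nonneg_left (by linarith) hκ0.le
      _ = c / 2 := by rw [hκ]; field_simp
  rw [e, Real.norm_of_nonneg hrs0]
  calc _ ≤ κ * ((r - s) * L) + (r - s) * (‖ψ'‖ * ((r - s) * L)) + (r - s) * (κ * ‖v‖) :=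
        (_root_.norm_sub_le _ _).trans (add_le_add ((norm_add_le _ _).trans (add_le_add b3 b2)) b4)
    _ = (r - s) * (κ * (L + ‖v‖) + ‖ψ'‖ * L * (r - s)) := by ring
    _ ≤ (r - s) * c := by gcongr; linarith
    _ = _ := mul_comm _ _

theorem IsWeakLimit.continuous (hT : IsWeakLimit F t T) (hF : IsStable F a M) (ht : 0 < t)
    {D : Set E} (hD : Dense D) (h : ∀ x ∈ D, ∃ y,
      Tendsto (fun h : ℝ≥0 => (((h : ℝ) : 𝕜))⁻¹ • (F h x - x)) (𝓝[>] 0) (𝓝 y)) (f : E) :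
    Continuous fun s => T s f := by
  rw [continuous_iff_continuousAt]
  intro s
  have hM := hF.one_le
  have hnhds : Set.Iic (s + 1) ∈ 𝓝 s := Iic_mem_nhds (lt_add_one s)
  refine tendsto_of_dense (C := M * Real.exp (a * (s + 1))) ?_ hD (fun x hx => ?_) f
  · filter_upwards [hnhds] with r hr
    refine (hT.norm_le hF r).trans ?_
    have := hF.nonneg
    have hr' : (r : ℝ) ≤ s + 1 := by exact_mod_cast hr
    gcongr
  · obtain ⟨y, hy⟩ := h x hx
    set L := M * Real.exp (a * (s + 1)) * (‖y‖ + 1) with hL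
    rw [tendsto_iff_norm_sub_tendsto_zero]
    have h0 : Tendsto (fun r : ℝ≥0 => |(r : ℝ) - s| * L) (𝓝 s) (𝓝 0) := by
      have : Continuous fun r : ℝ≥0 => |(r : ℝ) - s| * L := by fun_prop
      simpa using this.tendsto s
    refine squeeze_zero' (Eventually.of_forall fun _ => norm_nonneg _) ?_ h0
    filter_upwards [hnhds] with r hr
    have hr' : (r : ℝ) ≤ s + 1 := by exact_mod_cast hr
    rcases le_total s r with hsr | hsr
    · have := hT.norm_sub_le hF ht hy hsr hr'
      rwa [abs_of_nonneg (by rw [sub_nonneg]; exact_mod_cast hsr)]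
    · have := hT.norm_sub_le hF ht hy hsr (by linarith : (s : ℝ) ≤ s + 1)
      rwa [abs_sub_comm, abs_of_nonneg (by rw [sub_nonneg]; exact_mod_cast hsr), norm_sub_rev]

/-- `s ↦ T s f` solves, in the weak sense, the Cauchy problem of the closure of `Z`. -/
def IsWeakSolution (Z : E →ₗ.[𝕜] E) (T : ℝ≥0 → E →L[𝕜] E) (f : E) : Prop :=
  ∀ s : ℝ≥0, ∃ v : E,
    (∀ Φ Ψ : StrongDual 𝕜 E, (∀ x : Z.domain, Φ (Z x) = Ψ x) → Φ v = Ψ (T s f)) ∧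
    ∀ φ : StrongDual 𝕜 E,
      HasDerivWithinAt (fun r : ℝ => φ (T r.toNNReal f)) (φ v) (Set.Ici (s : ℝ)) s

/-- The range of `a + 2 - Z` is dense if there are sufficiently many weak solutions of exponential
growth at most `a`. -/
theorem dense_range_of_isWeakSolution (hT0 : T 0 = 1)
    (hTn : ∀ s : ℝ≥0, ‖T s‖ ≤ M * Real.exp (a * s)) (hTc : ∀ f, Continuous fun s => T s f)
    {D : Set E} (hD : Dense D) (hsol : ∀ f ∈ D, IsWeakSolution Z T f) :
    Dense (Set.range fun x : Z.domain => ((a + 2 : ℝ) : 𝕜) • (x : E) - Z x) := by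
  have := dense_of_forall_dual_eq_zero
    (LinearMap.range (((a + 2 : ℝ) : 𝕜) • Z.domain.subtype - Z.toFun)) (by
    intro φ hφ
    have hφZ : ∀ x : Z.domain, φ (Z x) = (((a + 2 : ℝ) : 𝕜) • φ) x := by
      intro x
      have : φ (((a + 2 : ℝ) : 𝕜) • (x : E) - Z x) = 0 := hφ _ ⟨x, rfl⟩
      rw [map_sub, map_smul, sub_eq_zero] at this
      exact this.symm
    have hzero : ∀ f ∈ D, φ f = 0 := by
      intro f hf
      set g : ℝ → 𝕜 := fun r => Real.exp (-((a + 2) * r)) • φ (T r.toNNReal f) with hg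
      have hgc : Continuous g := by
        have h1 : Continuous fun r : ℝ => T r.toNNReal f := (hTc f).comp continuous_real_toNNReal
        fun_prop
      have hconst : ∀ S : ℝ, 0 ≤ S → g S = g 0 := by
        intro S hS
        refine constant_of_has_deriv_right_zero hgc.continuousOn (fun r hr => ?_) S ⟨hS, le_rfl⟩
        obtain ⟨v, hv, hder⟩ := hsol f hf ⟨r, hr.1⟩
        have h1 := hder φ
        rw [hv φ _ hφZ] at h1
        have h2 : HasDerivAt (fun r : ℝ => Real.exp (-((a + 2) * r)))
            (Real.exp (-((a + 2) * r)) * -((a + 2) * 1)) r :=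
          (((hasDerivAt_id r).const_mul (a + 2)).neg).exp
        have h3 := h2.hasDerivWithinAt.smul h1
        refine h3.congr_deriv ?_
        have h4 : r.toNNReal = ⟨r, hr.1⟩ := Real.toNNReal_of_nonneg hr.1
        rw [h4]
        simp only [smul_apply, smul_eq_mul, RCLike.real_smul_eq_coe_mul]
        push_cast
        ring
      have hbound : ∀ S : ℝ, 0 ≤ S → ‖φ f‖ ≤ ‖φ‖ * M * ‖f‖ * Real.exp (-S) := by
        intro S hS
        have h1 := hconst S hS
        have h2 : g 0 = φ f := by simp [hg, hT0]
        rw [← h2, ← h1, hg]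
        rw [norm_smul, Real.norm_of_nonneg (Real.exp_pos _).le]
        have h3 : ‖φ (T S.toNNReal f)‖ ≤ ‖φ‖ * (M * Real.exp (a * S) * ‖f‖) := by
          refine (φ.le_opNorm _).trans ?_
          gcongr
          refine ((T S.toNNReal).le_opNorm f).trans ?_
          gcongr
          have := hTn S.toNNReal
          rwa [Real.coe_toNNReal S hS] at this
        have hM0 : 0 ≤ M := by
          have := (norm_nonneg _).trans (hTn 0)
          simpa using this
        calc _ ≤ Real.exp (-((a + 2) * S)) * (‖φ‖ * (M * Real.exp (a * S) * ‖f‖)) := by gcongr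
          _ = ‖φ‖ * M * ‖f‖ * Real.exp (-(2 * S)) := by
            have : Real.exp (-(2 * S)) = Real.exp (-((a + 2) * S)) * Real.exp (a * S) := by
              rw [← Real.exp_add]; ring_nf
            rw [this]; ring
          _ ≤ _ := by gcongr; linarith
      have hlim : Tendsto (fun S : ℝ => ‖φ‖ * M * ‖f‖ * Real.exp (-S)) atTop (𝓝 0) := by
        simpa using (Real.tendsto_exp_neg_atTop_nhds_zero).const_mul (‖φ‖ * M * ‖f‖)
      have h5 := ge_of_tendsto hlim ((eventually_ge_atTop 0).mono hbound)
      exact norm_le_zero_iff.1 h5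
    ext f
    exact (isClosed_eq φ.continuous continuous_const).closure_subset_iff.2 hzero (hD f))
  exact this

/-- The closure of the graph of `Z` in terms of the resolvent. -/
theorem mem_closure_graph_iff {l : 𝕜} {R : E →L[𝕜] E} (hR : ∀ x : Z.domain, R (l • (x : E) - Z x) = x)
    (hd : Dense (Set.range fun x : Z.domain => l • (x : E) - Z x)) {x y : E} :
    (x, y) ∈ Z.graph.topologicalClosure ↔ R (l • x - y) = x := by
  constructor
  · intro h
    have hcl : IsClosed {p : E × E | R (l • p.1 - p.2) = p.1} :=
      isClosed_eq (by fun_prop) (by fun_prop)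
    refine hcl.closure_subset_iff.2 ?_ h
    rintro ⟨u, w⟩ hp
    obtain ⟨z, rfl, rfl⟩ := LinearPMap.mem_graph_iff _ |>.1 hp
    exact hR z
  · intro h
    have hcl : IsClosed {g : E | (R g, l • R g - g) ∈ Z.graph.topologicalClosure} :=
      Z.graph.isClosed_topologicalClosure.preimage (by fun_prop)
    have hall : ∀ g, (R g, l • R g - g) ∈ Z.graph.topologicalClosure := fun g => by
      refine hcl.closure_subset_iff.2 ?_ (hd g)
      rintro _ ⟨z, rfl⟩
      change (R (l • (z : E) - Z z), l • R (l • (z : E) - Z z) - (l • (z : E) - Z z)) ∈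
        Z.graph.topologicalClosure
      rw [hR z, sub_sub_cancel]
      exact Z.graph.le_topologicalClosure (Z.mem_graph z)
    have := hall (l • x - y)
    rwa [h, sub_sub_cancel] at this

theorem eq_zero_of_mem_closure_graph {D : Set (StrongDual 𝕜 E)} (hD : Dense D)
    (h : ∀ ψ ∈ D, ∃ ψ' : StrongDual 𝕜 E, ∀ x : Z.domain, ψ (Z x) = ψ' x) {y : E}
    (hy : ((0 : E), y) ∈ Z.graph.topologicalClosure) : y = 0 := by
  have key : ∀ ψ ∈ D, ψ y = 0 := by
    intro ψ hψ
    obtain ⟨ψ', hψ'⟩ := h ψ hψ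
    have hcl : IsClosed {p : E × E | ψ p.2 = ψ' p.1} := isClosed_eq (by fun_prop) (by fun_prop)
    have : ((0 : E), y) ∈ {p : E × E | ψ p.2 = ψ' p.1} := by
      refine hcl.closure_subset_iff.2 ?_ hy
      rintro ⟨u, w⟩ hp
      obtain ⟨z, rfl, rfl⟩ := LinearPMap.mem_graph_iff _ |>.1 hp
      exact hψ' z
    simpa using this
  refine eq_of_forall_dual_eq (𝕜 := 𝕜) fun φ => ?_
  rw [map_zero]
  exact (isClosed_eq (NormedSpace.inclusionInDoubleDual 𝕜 E y).continuous
    continuous_const).closure_subset_iff.2 key (hD φ)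

theorem isClosable_of_forall {Z : E →ₗ.[𝕜] E}
    (h : ∀ y, ((0 : E), y) ∈ Z.graph.topologicalClosure → y = 0) : Z.IsClosable :=
  ⟨Z.graph.topologicalClosure.toLinearPMap, (Submodule.toLinearPMap_graph_eq _ (by
    rintro ⟨x, y⟩ hxy hx
    obtain rfl : x = 0 := hx
    exact h y hxy)).symm⟩

end WeakSolution

section Semigroup

variable {𝕜 E : Type*} [RCLike 𝕜] [NormedAddCommGroup E] [NormedSpace 𝕜 E]

theorem IsC0Semigroup.comm {T : ℝ≥0 → E →L[𝕜] E} (hT : IsC0Semigroup T) (r s : ℝ≥0) (f : E) :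
    T r (T s f) = T s (T r f) := by
  rw [← clm_mul_apply, ← hT.map_add, add_comm, hT.map_add, clm_mul_apply]

theorem IsC0Semigroup.apply_mem_graph {T : ℝ≥0 → E →L[𝕜] E} (hT : IsC0Semigroup T) {x y : E}
    (h : (x, y) ∈ (derivAtZero T).graph) (s : ℝ≥0) : (T s x, T s y) ∈ (derivAtZero T).graph := by
  rw [mem_graph_derivAtZero] at h ⊢
  refine (((T s).continuous.tendsto _).comp h).congr fun r => ?_
  simp [hT.comm r s, hT.map_zero]

variable [NormedSpace ℝ E] [IsScalarTower ℝ 𝕜 E]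

theorem tendsto_inv_smul_iff_hasDerivWithinAt {u : ℝ≥0 → E} {y : E} :
    Tendsto (fun h : ℝ≥0 => (((h : ℝ) : 𝕜))⁻¹ • (u h - u 0)) (𝓝[>] 0) (𝓝 y) ↔
      HasDerivWithinAt (fun r : ℝ => u r.toNNReal) y (Set.Ici 0) 0 := by
  rw [← hasDerivWithinAt_Ioi_iff_Ici, hasDerivWithinAt_iff_tendsto_slope' (by simp)]
  constructor
  · intro h
    have h1 : Tendsto Real.toNNReal (𝓝[>] 0) (𝓝[>] 0) := by
      refine tendsto_nhdsWithin_iff.2 ⟨?_, ?_⟩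
      · have := (continuous_real_toNNReal.tendsto 0).mono_left
          (nhdsWithin_le_nhds (s := Set.Ioi (0 : ℝ)))
        simpa using this
      · filter_upwards [self_mem_nhdsWithin] with r hr
        exact Real.toNNReal_pos.2 hr
    refine (h.comp h1).congr' ?_
    filter_upwards [self_mem_nhdsWithin] with r hr
    have hr' : (0 : ℝ) ≤ r := le_of_lt hr
    simp [slope_def_module, Real.coe_toNNReal r hr', RCLike.real_smul_eq_coe_smul (K := 𝕜)]
  · intro h
    have h1 : Tendsto ((↑) : ℝ≥0 → ℝ) (𝓝[>] 0) (𝓝[>] 0) := by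
      refine tendsto_nhdsWithin_iff.2 ⟨?_, ?_⟩
      · exact (NNReal.continuous_coe.tendsto 0).mono_left nhdsWithin_le_nhds
      · filter_upwards [self_mem_nhdsWithin] with r hr
        exact_mod_cast hr
    refine (h.comp h1).congr fun r => ?_
    simp [slope_def_module, RCLike.real_smul_eq_coe_smul (K := 𝕜)]

theorem hasDerivWithinAt_clm_apply {u : ℝ → E} {y : E} {S : Set ℝ} {s : ℝ}
    (h : HasDerivWithinAt u y S s) (R : E →L[𝕜] E) :
    HasDerivWithinAt (fun r => R (u r)) (R y) S s :=
  (R.restrictScalars ℝ).hasFDerivAt.comp_hasDerivWithinAt s h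

theorem hasDerivWithinAt_shift {u : ℝ → E} {y : E} {s c : ℝ}
    (h : HasDerivWithinAt u y (Set.Ici (s + c)) (s + c)) :
    HasDerivWithinAt (fun r => u (r + c)) y (Set.Ici s) s := by
  have h1 : HasDerivWithinAt (fun r : ℝ => r + c) 1 (Set.Ici s) s :=
    ((hasDerivAt_id s).add_const c).hasDerivWithinAt
  have := HasDerivWithinAt.scomp s h h1 (fun r hr => add_le_add_left hr c)
  simpa [Function.comp_def] using this

theorem exists_integral_operator {T : ℝ≥0 → E →L[𝕜] E} (hTc : ∀ f, Continuous fun s => T s f)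
    {b C : ℝ} (hb : 0 ≤ b) (hC : ∀ s : ℝ≥0, s ≤ b → ‖T s‖ ≤ C) :
    ∃ V : E →L[𝕜] E, ∀ f, V f = ∫ r in (0 : ℝ)..b, T r.toNNReal f := by
  have hc : ∀ f, Continuous fun r : ℝ => T r.toNNReal f := fun f =>
    (hTc f).comp continuous_real_toNNReal
  refine ⟨LinearMap.mkContinuous
    { toFun := fun f => ∫ r in (0 : ℝ)..b, T r.toNNReal f
      map_add' := fun f g => ?_
      map_smul' := fun c f => ?_ } (C * |b - 0|) fun f => ?_, fun f => rfl⟩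
  · simp only [map_add]
    exact intervalIntegral.integral_add ((hc f).intervalIntegrable _ _)
      ((hc g).intervalIntegrable _ _)
  · simp only [map_smul]
    exact intervalIntegral.integral_smul c _
  · rw [mul_right_comm]
    refine intervalIntegral.norm_integral_le_of_norm_le_const fun r hr => ?_
    rw [Set.uIoc_of_le hb] at hr
    refine (ContinuousLinearMap.le_opNorm _ _).trans ?_
    gcongr
    exact hC _ (by rw [Real.coe_toNNReal r hr.1.le]; exact hr.2)

/-- Weak solutions for a dense set of initial values make all orbits mild solutions. -/
theorem isMild_of_isWeakSolution [CompleteSpace E] {T : ℝ≥0 → E →L[𝕜] E} {Z : E →ₗ.[𝕜] E}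
    {R : E →L[𝕜] E} {a M : ℝ} (ha : 0 ≤ a) (hT0 : T 0 = 1)
    (hTn : ∀ s : ℝ≥0, ‖T s‖ ≤ M * Real.exp (a * s)) (hTc : ∀ f, Continuous fun s => T s f)
    (hR : ∀ x : Z.domain, R (((a + 2 : ℝ) : 𝕜) • (x : E) - Z x) = x)
    {D : Set E} (hD : Dense D) (hsol : ∀ f ∈ D, IsWeakSolution Z T f) (f : E) :
    IsMild R a fun r => T r.toNNReal f := by
  have hc : ∀ f, Continuous fun r : ℝ => T r.toNNReal f := fun f =>
    (hTc f).comp continuous_real_toNNReal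
  have hM0 : 0 ≤ M := by simpa using (norm_nonneg _).trans (hTn 0)
  have hint : ∀ f ∈ D, ∀ b : ℝ, 0 ≤ b → R (T b.toNNReal f) - R f =
      (a + 2) • R (∫ r in (0 : ℝ)..b, T r.toNNReal f) - ∫ r in (0 : ℝ)..b, T r.toNNReal f := by
    intro f hf b hb
    refine eq_of_forall_dual_eq (𝕜 := 𝕜) fun φ => ?_
    have hii := (hc f).intervalIntegrable (μ := MeasureTheory.volume) 0 b
    set Φ : StrongDual 𝕜 E := ((a + 2 : ℝ) : 𝕜) • φ.comp R - φ with hΦ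
    have h1 := intervalIntegral.integral_eq_sub_of_hasDeriv_right_of_le
      (f := fun r : ℝ => φ (R (T r.toNNReal f))) (f' := fun r : ℝ => Φ (T r.toNNReal f)) hb
      (by have := hc f; fun_prop) (fun r hr => by
        obtain ⟨v, hv, hder⟩ := hsol f hf ⟨r, hr.1.le⟩
        have h2 := hder (φ.comp R)
        rw [hv (φ.comp R) Φ (fun x => by
          have h3 := congrArg φ (hR x)
          simp only [map_sub, map_smul] at h3
          simp only [hΦ, ContinuousLinearMap.comp_apply, sub_apply, smul_apply]
          rw [← h3]; abel)] at h2
        have h4 : r.toNNReal = ⟨r, hr.1.le⟩ := Real.toNNReal_of_nonneg hr.1.le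
        rw [h4]
        exact h2.mono Set.Ioi_subset_Ici_self)
      ((Φ.continuous.comp (hc f)).intervalIntegrable _ _)
    rw [Φ.intervalIntegral_comp_comm hii] at h1
    have h5 : T (0 : ℝ).toNNReal f = f := by simp [hT0]
    rw [h5] at h1
    rw [map_sub, map_sub, ← h1, hΦ, RCLike.real_smul_eq_coe_smul (K := 𝕜), map_smul]
    rfl
  have hall : ∀ b : ℝ, 0 ≤ b → ∀ f, R (T b.toNNReal f) - R f =
      (a + 2) • R (∫ r in (0 : ℝ)..b, T r.toNNReal f) - ∫ r in (0 : ℝ)..b, T r.toNNReal f := by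
    intro b hb f
    obtain ⟨V, hV⟩ := exists_integral_operator hTc hb (C := M * Real.exp (a * b)) fun s hs =>
      (hTn s).trans (by gcongr)
    have h1 : (fun f => R (T b.toNNReal f) - R f) = fun f => (a + 2) • R (V f) - V f :=
      Continuous.ext_on hD (by fun_prop) (by fun_prop) fun f hf => by
        simp only [hV]
        exact hint f hf b hb
    simpa [hV] using congrFun h1 f
  refine ⟨hc f, fun s hs => ?_⟩
  have h1 : HasDerivAt (fun b : ℝ => ∫ r in (0 : ℝ)..b, T r.toNNReal f) (T s.toNNReal f) s :=
    ((hc f).integral_hasStrictDerivAt 0 s).hasDerivAt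
  have h2 := (((hasDerivWithinAt_clm_apply (h1.hasDerivWithinAt (s := Set.Ici s)) R).const_smul (a + 2)).sub
    h1.hasDerivWithinAt).const_add (R f)
  refine h2.congr_of_mem (fun r hr => ?_) Set.self_mem_Ici
  have := hall r (hs.trans hr) f
  simp only [Pi.sub_apply, Pi.smul_apply]
  rw [← this]
  abel

/-- A mild solution operator is a semigroup which commutes with the resolvent. -/
theorem add_and_comm_of_isMild {F Q T : ℝ≥0 → E →L[𝕜] E} {R : E →L[𝕜] E} {a M : ℝ}
    (hF : IsStable F a M) (hQ : IsResolventLimit F Q R a M) (hinj : ∀ x, R x = 0 → x = 0)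
    (hT0 : T 0 = 1) (hm : ∀ f, IsMild R a fun r => T r.toNNReal f) :
    (∀ l m : ℝ≥0, T (l + m) = T l * T m) ∧ ∀ (s : ℝ≥0) (f : E), R (T s f) = T s (R f) := by
  refine ⟨fun l m => ?_, fun s f => ?_⟩
  · ext f
    have h1 : IsMild R a fun r => T (r + m).toNNReal f := by
      refine ⟨(hm f).continuous.comp (continuous_add_const (m : ℝ)), fun s hs => ?_⟩
      exact hasDerivWithinAt_shift (u := fun r => R (T r.toNNReal f))
        ((hm f).hasDeriv (s + m) (by positivity))
    have := h1.unique hF hQ hinj (hm (T m f)) (by simp [hT0]) l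
    simp only [Real.toNNReal_coe, ← NNReal.coe_add] at this
    exact this
  · have h1 : IsMild R a fun r => R (T r.toNNReal f) := by
      refine ⟨R.continuous.comp (hm f).continuous, fun s hs => ?_⟩
      have := hasDerivWithinAt_clm_apply ((hm f).hasDeriv s hs) R
      rw [map_sub, RCLike.real_smul_eq_coe_smul (K := 𝕜), map_smul,
        ← RCLike.real_smul_eq_coe_smul (K := 𝕜)] at this
      exact this
    have := h1.unique hF hQ hinj (hm (R f)) (by simp [hT0]) s
    simpa using this

/-- The generator of a mild solution operator. -/
theorem mem_graph_derivAtZero_iff_of_isMild {T : ℝ≥0 → E →L[𝕜] E} {R : E →L[𝕜] E} {a : ℝ}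
    (hT0 : T 0 = 1) (hm : ∀ f, IsMild R a fun r => T r.toNNReal f)
    (hcomm : ∀ (s : ℝ≥0) (f : E), R (T s f) = T s (R f)) {x y : E} :
    (x, y) ∈ (derivAtZero T).graph ↔ R (((a + 2 : ℝ) : 𝕜) • x - y) = x := by
  rw [mem_graph_derivAtZero, tendsto_inv_smul_iff_hasDerivWithinAt (u := fun s => T s x)]
  have hd : ∀ f, HasDerivWithinAt (fun r : ℝ => R (T r.toNNReal f)) ((a + 2) • R f - f)
      (Set.Ici 0) 0 := by
    intro f
    simpa [hT0] using (hm f).hasDeriv 0 le_rfl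
  constructor
  · intro h
    have h1 := hasDerivWithinAt_clm_apply h R
    have h2 := (uniqueDiffWithinAt_Ici (0 : ℝ)).eq_deriv _ h1 (hd x)
    rw [map_sub, map_smul, h2, RCLike.real_smul_eq_coe_smul (K := 𝕜)]
    abel
  · intro h
    have h1 := hd (((a + 2 : ℝ) : 𝕜) • x - y)
    simp only [hcomm, h] at h1
    rwa [RCLike.real_smul_eq_coe_smul (K := 𝕜), sub_sub_cancel] at h1

/-- Orbits of a `C_0`-semigroup are mild solutions for the resolvent of its generator. -/
theorem IsC0Semigroup.isMild {T : ℝ≥0 → E →L[𝕜] E} (hT : IsC0Semigroup T) {R : E →L[𝕜] E} {a : ℝ}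
    (hgen : ∀ x y, (x, y) ∈ (derivAtZero T).graph ↔ R (((a + 2 : ℝ) : 𝕜) • x - y) = x) :
    (∀ f, IsMild R a fun r => T r.toNNReal f) ∧ ∀ (s : ℝ≥0) (f : E), R (T s f) = T s (R f) := by
  have hmem : ∀ f, (R f, ((a + 2 : ℝ) : 𝕜) • R f - f) ∈ (derivAtZero T).graph := fun f => by
    rw [hgen, sub_sub_cancel]
  have hcomm : ∀ (s : ℝ≥0) (f : E), R (T s f) = T s (R f) := by
    intro s f
    have h2 := hT.apply_mem_graph (hmem f) s
    rw [hgen] at h2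
    simpa using h2
  refine ⟨fun f => ⟨(hT.continuous f).comp continuous_real_toNNReal, fun s hs => ?_⟩, hcomm⟩
  lift s to ℝ≥0 using hs
  have h1 := mem_graph_derivAtZero.1 (hmem f)
  rw [tendsto_inv_smul_iff_hasDerivWithinAt (u := fun s => T s (R f))] at h1
  have h2 : HasDerivWithinAt (fun r : ℝ => T (r + -(s : ℝ)).toNNReal (R f))
      (((a + 2 : ℝ) : 𝕜) • R f - f) (Set.Ici (s : ℝ)) s :=
    hasDerivWithinAt_shift (u := fun r : ℝ => T r.toNNReal (R f)) (by simpa using h1)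
  have h3 := hasDerivWithinAt_clm_apply h2 (T s)
  simp only [hcomm]
  rw [map_sub, map_smul] at h3
  rw [Real.toNNReal_coe, RCLike.real_smul_eq_coe_smul (K := 𝕜)]
  refine h3.congr_of_mem (fun r hr => ?_) Set.self_mem_Ici
  have hr' : (s : ℝ) ≤ r := hr
  rw [← clm_mul_apply (T s), ← hT.map_add]
  congr 2
  ext
  rw [NNReal.coe_add, Real.coe_toNNReal r (s.2.trans hr'),
    Real.coe_toNNReal (r + -s) (by linarith)]
  ring

/-- Under the four conditions, `Z` is closable, its closure generates a `C_0`-semigroup, and the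
resolvent of the closure is the strong limit of the resolvents of the difference quotients. -/
theorem Conditions.exists_semigroup [CompleteSpace E] (hE : IsReflexiveSpace 𝕜 E)
    {Z : E →ₗ.[𝕜] E} {t : ℝ≥0} (ht : 0 < t) {F : ℝ≥0 → E →L[𝕜] E} (hc : Conditions Z t F) :
    Z.IsClosable ∧ (∃ T : ℝ≥0 → E →L[𝕜] E, IsGeneratorOf Z.closure T) ∧
      ∃ (a M : ℝ) (Q : ℝ≥0 → E →L[𝕜] E) (R : E →L[𝕜] E), IsStable F a M ∧
        IsResolventLimit F Q R a M ∧
        ∀ x y, (x, y) ∈ Z.closure.graph ↔ R (((a + 2 : ℝ) : 𝕜) • x - y) = x := by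
  obtain ⟨a, M, hF⟩ := hc.exists_isStable
  have hF0 := hc.map_zero
  have hder := tendsto_of_le_derivAtZero hF0 hc.extends_Z
  have hdual := dense_of_weak_star_dense hE _ hc.dual_dense
  obtain ⟨A, hAZ, hA, happ⟩ := hc.approx
  obtain ⟨T, hT⟩ := exists_isWeakLimit hE hF t
  have hTn := hT.norm_le hF
  have hT0 := hT.map_zero
  have hTc := hT.continuous hF ht hA fun x hx => ⟨_, hder ⟨x, hAZ hx⟩⟩
  have hpair : ∀ ψ : (derivAtZero (dualFamily F)).domain, ∀ x : Z.domain,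
      (ψ : StrongDual 𝕜 E) (Z x) = derivAtZero (dualFamily F) ψ x := fun ψ x =>
    dual_apply_eq hF0 (hder x) ψ
  have hsol : ∀ f ∈ (A : Set E), IsWeakSolution Z T f := by
    intro f hf s
    obtain ⟨g, hg, hb⟩ := happ f hf (s / t)
    obtain ⟨v, hv⟩ := hT.exists_generator_value hE hg hb
    exact ⟨v, hv, hT.hasDerivWithinAt hF hF0 ht hdual (hder ⟨f, hAZ hf⟩) fun ψ =>
      hv _ _ (hpair ψ)⟩
  have hrange := dense_range_of_isWeakSolution hT0 hTn hTc hA hsol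
  obtain ⟨Q, R, hQ, hR⟩ := exists_resolvent_limit hF hder hrange
  have hzero : ∀ y, ((0 : E), y) ∈ Z.graph.topologicalClosure → y = 0 := fun y hy =>
    eq_zero_of_mem_closure_graph hdual (fun ψ hψ => ⟨_, hpair ⟨ψ, hψ⟩⟩) hy
  have hgraph : ∀ x y, (x, y) ∈ Z.graph.topologicalClosure ↔
      R (((a + 2 : ℝ) : 𝕜) • x - y) = x := fun x y => mem_closure_graph_iff hR hrange
  have hcl := isClosable_of_forall hzero
  rw [hcl.graph_closure_eq_closure_graph] at hgraph
  have hinj : ∀ x, R x = 0 → x = 0 := by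
    intro x hx
    refine neg_eq_zero.1 (hzero (-x) ?_)
    rw [hcl.graph_closure_eq_closure_graph, hgraph]
    simpa using hx
  have hm := isMild_of_isWeakSolution hF.nonneg hT0 hTn hTc hR hA hsol
  obtain ⟨hadd, hcomm⟩ := add_and_comm_of_isMild hF hQ hinj hT0 hm
  refine ⟨hcl, ⟨T, ⟨hT0, hadd, hTc, M + 1, a, ?_, fun s => (hTn s).trans ?_⟩, ?_⟩,
    a, M, Q, R, hF, hQ, hgraph⟩
  · linarith [hF.one_le]
  · gcongr
    linarith
  · refine LinearPMap.eq_of_eq_graph ?_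
    ext ⟨x, y⟩
    rw [hgraph, mem_graph_derivAtZero_iff_of_isMild hT0 hm hcomm]

/-- Convergence of the Chernoff approximations. -/
theorem tendsto_pow_of_isGeneratorOf [CompleteSpace E] (hE : IsReflexiveSpace 𝕜 E)
    {Z : E →ₗ.[𝕜] E} (hZ : Dense (Z.domain : Set E)) {t : ℝ≥0} (ht : 0 < t)
    {F : ℝ≥0 → E →L[𝕜] E} (hc : Conditions Z t F) {T : ℝ≥0 → E →L[𝕜] E}
    (hT : IsGeneratorOf Z.closure T) {s : ℝ≥0} (hs : 0 < s) (f : E) :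
    Tendsto (fun n : ℕ => (F (s / n) ^ n) f) atTop (𝓝 (T s f)) := by
  obtain ⟨-, -, a, M, Q, R, hF, hQ, hgraph⟩ := hc.exists_semigroup hE ht
  rw [hT.2] at hgraph
  obtain ⟨hm, hcomm⟩ := hT.1.isMild hgraph
  have hRd : DenseRange R := by
    refine hZ.mono fun x hx => ?_
    have h1 : (x, Z ⟨x, hx⟩) ∈ (derivAtZero T).graph := by
      rw [← hT.2]
      exact LinearPMap.le_graph_of_le Z.le_closure (Z.mem_graph ⟨x, hx⟩)
    exact ⟨_, (hgraph _ _).1 h1⟩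
  refine tendsto_of_dense (C := M * Real.exp (a * s)) ?_ (hRd.comp hRd R.continuous) ?_ f
  · filter_upwards [eventually_gt_atTop 0] with n hn
    refine hF.pow_le_of_le (le_of_eq ?_)
    have : (n : ℝ) ≠ 0 := by exact_mod_cast hn.ne'
    push_cast
    field_simp
  · rintro _ ⟨x, rfl⟩
    have := (hm x).tendsto_pow hF hQ hs
    simpa [hT.1.map_zero, hcomm] using this

end Semigroup

section Necessity

variable {𝕜 E : Type*} [RCLike 𝕜] [NormedAddCommGroup E] [NormedSpace 𝕜 E]

theorem IsC0Semigroup.pow_eq {T : ℝ≥0 → E →L[𝕜] E} (hT : IsC0Semigroup T) (h : ℝ≥0) (m : ℕ) :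
    T h ^ m = T (h * m) := by
  induction m with
  | zero => simp [hT.map_zero]
  | succ m ih => rw [pow_succ, ih, ← hT.map_add]; push_cast; ring_nf

theorem IsC0Semigroup.exists_norm_le {T : ℝ≥0 → E →L[𝕜] E} (hT : IsC0Semigroup T) (b : ℝ) :
    ∃ C : ℝ, 0 ≤ C ∧ ∀ s : ℝ≥0, (s : ℝ) ≤ b → ‖T s‖ ≤ C := by
  obtain ⟨M, a, hM, h⟩ := hT.bound
  refine ⟨M * Real.exp (|a| * b), by positivity, fun s hs => (h s).trans ?_⟩
  have : a * s ≤ |a| * b :=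
    (mul_le_mul_of_nonneg_right (le_abs_self a) s.2).trans
      (mul_le_mul_of_nonneg_left hs (abs_nonneg a))
  gcongr

theorem IsC0Semigroup.continuous_orbit {T : ℝ≥0 → E →L[𝕜] E} (hT : IsC0Semigroup T) (f : E) :
    Continuous fun r : ℝ => T r.toNNReal f :=
  (hT.continuous f).comp continuous_real_toNNReal

section Averages

variable [NormedSpace ℝ E] {T : ℝ≥0 → E →L[𝕜] E}

theorem IsC0Semigroup.apply_integral [CompleteSpace E] (hT : IsC0Semigroup T) (r b : ℝ≥0) (f : E) :
    T r (∫ s in (0 : ℝ)..b, T s.toNNReal f) = ∫ s in (0 : ℝ)..b, T s.toNNReal (T r f) := by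
  rw [← (T r).intervalIntegral_comp_comm ((hT.continuous_orbit f).intervalIntegrable _ _)]
  simp only [hT.comm r]

theorem IsC0Semigroup.integral_apply (hT : IsC0Semigroup T) (r b : ℝ≥0) (f : E) :
    ∫ s in (0 : ℝ)..b, T s.toNNReal (T r f) =
      ∫ s in (r : ℝ)..(b + r : ℝ), T s.toNNReal f := by
  have h1 := intervalIntegral.integral_comp_add_right (a := 0) (b := b)
    (fun s : ℝ => T s.toNNReal f) (r : ℝ)
  rw [zero_add] at h1
  rw [← h1]
  refine intervalIntegral.integral_congr fun s hs => ?_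
  rw [Set.uIcc_of_le (NNReal.coe_nonneg b)] at hs
  rw [← clm_mul_apply, ← hT.map_add, Real.toNNReal_add hs.1 (NNReal.coe_nonneg r), Real.toNNReal_coe]

theorem IsC0Semigroup.apply_integral_sub [CompleteSpace E] (hT : IsC0Semigroup T) (r b : ℝ≥0)
    (f : E) :
    T r (∫ s in (0 : ℝ)..b, T s.toNNReal f) - ∫ s in (0 : ℝ)..b, T s.toNNReal f =
      ∫ s in (0 : ℝ)..r, T s.toNNReal (T b f - f) := by
  have hi : ∀ x y : ℝ, IntervalIntegrable (fun s : ℝ => T s.toNNReal f) MeasureTheory.volume x y :=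
    fun x y => (hT.continuous_orbit f).intervalIntegrable _ _
  have hi' : IntervalIntegrable (fun s : ℝ => T s.toNNReal (T b f)) MeasureTheory.volume 0 r :=
    (hT.continuous_orbit (T b f)).intervalIntegrable _ _
  simp only [map_sub]
  rw [hT.apply_integral, hT.integral_apply, intervalIntegral.integral_sub hi' (hi _ _),
    hT.integral_apply, add_comm (r : ℝ),
    intervalIntegral.integral_interval_sub_interval_comm (hi _ _) (hi _ _) (hi _ _),
    intervalIntegral.integral_symm 0 (r : ℝ), intervalIntegral.integral_symm (b : ℝ) (b + r : ℝ)]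
  abel

variable [IsScalarTower ℝ 𝕜 E]

theorem IsC0Semigroup.exists_integral (hT : IsC0Semigroup T) :
    ∃ V : ℝ≥0 → E →L[𝕜] E, ∀ b f, V b f = ∫ r in (0 : ℝ)..b, T r.toNNReal f := by
  have : ∀ b : ℝ≥0, ∃ V : E →L[𝕜] E, ∀ f, V f = ∫ r in (0 : ℝ)..b, T r.toNNReal f := fun b => by
    obtain ⟨C, -, hC⟩ := hT.exists_norm_le b
    exact exists_integral_operator hT.continuous b.2 hC
  choose V hV using this
  exact ⟨V, hV⟩

/-- Functionals which are averaged twice along the semigroup lie in the domain of the derivative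
of the dual semigroup. -/
theorem IsC0Semigroup.average_mem_domain [CompleteSpace E] (hT : IsC0Semigroup T)
    {V : ℝ≥0 → E →L[𝕜] E} (hV : ∀ b f, V b f = ∫ r in (0 : ℝ)..b, T r.toNNReal f)
    (φ : StrongDual 𝕜 E) (h k : ℝ≥0) :
    (φ.comp (V h)).comp (V k) ∈ (derivAtZero (dualFamily T)).domain := by
  obtain ⟨C, hC0, hC⟩ := hT.exists_norm_le 1
  have hcomm : ∀ r b f, T r (V b f) = V b (T r f) := fun r b f => by
    rw [hV, hV, hT.apply_integral]
  have hsub : ∀ r b f, T r (V b f) - V b f = V r (T b f - f) := fun r b f => by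
    rw [hV, hV, hT.apply_integral_sub]
  have hVn : ∀ (r : ℝ≥0) (f : E), (r : ℝ) ≤ 1 → ‖V r f‖ ≤ C * ‖f‖ * r := by
    intro r f hr
    rw [hV]
    refine (intervalIntegral.norm_integral_le_of_norm_le_const (C := C * ‖f‖) fun s hs => ?_).trans
      (le_of_eq (by simp))
    rw [Set.uIoc_of_le (NNReal.coe_nonneg r)] at hs
    refine (ContinuousLinearMap.le_opNorm _ _).trans ?_
    gcongr
    exact hC _ (by rw [Real.coe_toNNReal s hs.1.le]; exact hs.2.trans hr)
  set G : E →L[𝕜] E := (T h - 1) * V k with hG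
  set K := (‖T h‖ + 1) * (C * (‖T k‖ + 1)) with hK
  have hTG : ∀ (s : ℝ≥0) (f : E), (s : ℝ) ≤ 1 → ‖T s (G f) - G f‖ ≤ K * ‖f‖ * s := by
    intro s f hs
    have e : T s (G f) - G f = (T h - 1) (V s (T k f - f)) := by
      rw [← hsub]
      simp only [hG, clm_mul_apply, sub_apply, map_sub, hT.comm s h]
      simp
    rw [e]
    have b1 : ‖T h - 1‖ ≤ ‖T h‖ + 1 :=
      (norm_sub_le _ _).trans (by gcongr; exact ContinuousLinearMap.norm_id_le)
    have b2 : ‖T k f - f‖ ≤ (‖T k‖ + 1) * ‖f‖ := by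
      refine (norm_sub_le _ _).trans ?_
      rw [add_mul, one_mul]
      gcongr
      exact (T k).le_opNorm f
    calc _ ≤ ‖T h - 1‖ * ‖V s (T k f - f)‖ := ContinuousLinearMap.le_opNorm _ _
      _ ≤ (‖T h‖ + 1) * (C * ((‖T k‖ + 1) * ‖f‖) * s) := by
        gcongr
        exact (hVn s _ hs).trans (by gcongr)
      _ = _ := by rw [hK]; ring
  refine ⟨φ.comp G, ?_⟩
  rw [tendsto_iff_norm_sub_tendsto_zero]
  have h0 : Tendsto (fun r : ℝ≥0 => ‖φ‖ * (K * r)) (𝓝[>] 0) (𝓝 0) := by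
    have : Continuous fun r : ℝ≥0 => ‖φ‖ * (K * (r : ℝ)) := by fun_prop
    simpa using (this.tendsto 0).mono_left nhdsWithin_le_nhds
  refine squeeze_zero' (Eventually.of_forall fun _ => norm_nonneg _) ?_ h0
  filter_upwards [self_mem_nhdsWithin,
    mem_nhdsWithin_of_mem_nhds (Iic_mem_nhds (zero_lt_one' ℝ≥0))] with r hr hr1
  have hr0 : (0 : ℝ) < r := by exact_mod_cast hr
  have hr1' : (r : ℝ) ≤ 1 := by exact_mod_cast hr1
  have hrne : ((r : ℝ) : 𝕜) ≠ 0 := by exact_mod_cast hr0.ne'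
  refine ContinuousLinearMap.opNorm_le_bound _ (by positivity) fun f => ?_
  have e1 : V h (V k (T r f)) - V h (V k f) = V r (G f) := by
    rw [← hcomm, ← hcomm, hsub]
    rfl
  have e : ((((r : ℝ) : 𝕜))⁻¹ • (dualFamily T r ((φ.comp (V h)).comp (V k)) -
      dualFamily T 0 ((φ.comp (V h)).comp (V k))) - φ.comp G) f =
      φ ((((r : ℝ) : 𝕜))⁻¹ • (V r (G f) - ((r : ℝ) : 𝕜) • G f)) := by
    rw [smul_sub (((r : ℝ) : 𝕜))⁻¹ (V r (G f)), inv_smul_smul₀ hrne, ← e1]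
    simp [dualFamily_apply, hT.map_zero]
  have e2 : ‖V r (G f) - ((r : ℝ) : 𝕜) • G f‖ ≤ K * ‖f‖ * r * r := by
    have h1 : V r (G f) - ((r : ℝ) : 𝕜) • G f =
        ∫ s in (0 : ℝ)..r, (T s.toNNReal (G f) - G f) := by
      rw [intervalIntegral.integral_sub ((hT.continuous_orbit (G f)).intervalIntegrable _ _)
        (continuous_const.intervalIntegrable _ _), ← hV,
        intervalIntegral.integral_const, sub_zero, RCLike.real_smul_eq_coe_smul (K := 𝕜)]
    rw [h1]
    refine (intervalIntegral.norm_integral_le_of_norm_le_const (C := K * ‖f‖ * r)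
      fun s hs => ?_).trans (le_of_eq (by simp))
    rw [Set.uIoc_of_le (NNReal.coe_nonneg r)] at hs
    have hs' : ((s.toNNReal : ℝ≥0) : ℝ) = s := Real.coe_toNNReal s hs.1.le
    refine (hTG _ f (by rw [hs']; exact hs.2.trans hr1')).trans ?_
    rw [hs']
    gcongr
    exact hs.2
  rw [e, mul_assoc]
  refine (φ.le_opNorm _).trans ?_
  gcongr
  rw [norm_smul, norm_inv, RCLike.norm_ofReal, abs_of_pos hr0, inv_mul_le_iff₀ hr0]
  exact e2.trans (le_of_eq (by ring))

/-- The derivative of the dual of a `C_0`-semigroup has weak-* dense domain. -/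
theorem IsC0Semigroup.dual_dense [CompleteSpace E] (hT : IsC0Semigroup T) :
    Dense {φ : WeakDual 𝕜 E |
      WeakDual.toStrongDual φ ∈ (derivAtZero (dualFamily T)).domain} := by
  obtain ⟨V, hV⟩ := hT.exists_integral
  set D := {φ : WeakDual 𝕜 E | WeakDual.toStrongDual φ ∈ (derivAtZero (dualFamily T)).domain}
  have hlim : ∀ f, Tendsto (fun h : ℝ≥0 => (((h : ℝ) : 𝕜))⁻¹ • V h f) (𝓝[>] 0) (𝓝 f) := by
    intro f
    have hV0 : V 0 f = 0 := by simp [hV]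
    have h1 : Tendsto (fun h : ℝ≥0 => (((h : ℝ) : 𝕜))⁻¹ • (V h f - V 0 f)) (𝓝[>] 0) (𝓝 f) := by
      rw [tendsto_inv_smul_iff_hasDerivWithinAt (u := fun h => V h f)]
      have h2 : HasDerivAt (fun b : ℝ => ∫ r in (0 : ℝ)..b, T r.toNNReal f)
          (T (0 : ℝ).toNNReal f) 0 :=
        ((hT.continuous_orbit f).integral_hasStrictDerivAt 0 0).hasDerivAt
      have h3 : T (0 : ℝ).toNNReal f = f := by simp [hT.map_zero]
      rw [h3] at h2
      refine h2.hasDerivWithinAt.congr_of_mem (fun b hb => ?_) Set.self_mem_Ici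
      rw [hV, Real.coe_toNNReal b hb]
    simpa [hV0] using h1
  have hcl : ∀ φ : StrongDual 𝕜 E,
      (∀ h : ℝ≥0, StrongDual.toWeakDual ((((h : ℝ) : 𝕜))⁻¹ • φ.comp (V h)) ∈ closure D) →
      StrongDual.toWeakDual φ ∈ closure D := by
    intro φ hφ
    refine isClosed_closure.mem_of_tendsto (b := 𝓝[>] (0 : ℝ≥0))
      (f := fun h : ℝ≥0 => StrongDual.toWeakDual ((((h : ℝ) : 𝕜))⁻¹ • φ.comp (V h))) ?_
      (Eventually.of_forall hφ)
    rw [tendsto_iff_forall_eval_tendsto_topDualPairing]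
    intro f
    refine ((φ.continuous.tendsto f).comp (hlim f)).congr fun h => ?_
    exact map_smul φ _ _
  intro φ
  refine hcl (WeakDual.toStrongDual φ) fun h => hcl _ fun k => subset_closure ?_
  have h1 := hT.average_mem_domain hV (WeakDual.toStrongDual φ) h k
  have h2 := (derivAtZero (dualFamily T)).domain.smul_mem
    ((((k : ℝ) : 𝕜))⁻¹ * (((h : ℝ) : 𝕜))⁻¹) h1
  have h3 : (((k : ℝ) : 𝕜))⁻¹ • ((((h : ℝ) : 𝕜))⁻¹ • (WeakDual.toStrongDual φ).comp (V h)).comp (V k) =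
      ((((k : ℝ) : 𝕜))⁻¹ * (((h : ℝ) : 𝕜))⁻¹) •
        ((WeakDual.toStrongDual φ).comp (V h)).comp (V k) := by
    ext f
    simp [mul_assoc]
  rw [← h3] at h2
  exact h2

end Averages

theorem IsGeneratorOf.exists_approx {Z : E →ₗ.[𝕜] E} (hcl : Z.IsClosable) {T : ℝ≥0 → E →L[𝕜] E}
    (hT : IsGeneratorOf Z.closure T) (t : ℝ≥0) {f : E} (hf : f ∈ Z.domain) (s : ℝ≥0) :
    ∃ g : ℕ → Z.domain,
      Tendsto (fun n : ℕ => ‖(T (t / n) ^ ⌊(n : ℝ≥0) * s⌋₊) f - (g n : E)‖) atTop (𝓝 0) ∧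
      Bornology.IsBounded (Set.range fun n => Z (g n)) := by
  set r : ℕ → ℝ≥0 := fun n => t / n * (⌊(n : ℝ≥0) * s⌋₊ : ℕ) with hr
  have hrle : ∀ n, r n ≤ t * s := fun n => by
    calc t / n * (⌊(n : ℝ≥0) * s⌋₊ : ℕ) ≤ t / n * (n * s) := by
          gcongr; exact Nat.floor_le zero_le
      _ ≤ t * s := by
        rcases eq_or_ne (n : ℝ≥0) 0 with hn | hn
        · simp [hn]
        · rw [← mul_assoc, div_mul_cancel₀ _ hn]
  obtain ⟨C, hC0, hC⟩ := hT.1.exists_norm_le (t * s)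
  have hmem : ∀ n : ℕ, ∃ g : Z.domain, ‖T (r n) f - g‖ < 1 / (n + 1) ∧
      ‖T (r n) (Z ⟨f, hf⟩) - Z g‖ < 1 / (n + 1) := by
    intro n
    have h1 : (f, Z ⟨f, hf⟩) ∈ (derivAtZero T).graph := by
      rw [← hT.2]
      exact LinearPMap.le_graph_of_le Z.le_closure (Z.mem_graph ⟨f, hf⟩)
    have h2 := hT.1.apply_mem_graph h1 (r n)
    rw [← hT.2, ← hcl.graph_closure_eq_closure_graph] at h2
    obtain ⟨p, hp, hd⟩ := Metric.mem_closure_iff.1 h2 (1 / (n + 1)) Nat.one_div_pos_of_nat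
    obtain ⟨g, hg1, hg2⟩ := (LinearPMap.mem_graph_iff _).1 hp
    rw [Prod.dist_eq, max_lt_iff, dist_eq_norm, dist_eq_norm, ← hg1, ← hg2] at hd
    exact ⟨g, hd⟩
  choose g hg1 hg2 using hmem
  refine ⟨g, ?_, ?_⟩
  · refine squeeze_zero (fun _ => norm_nonneg _) (fun n => ?_)
      (tendsto_one_div_add_atTop_nhds_zero_nat (𝕜 := ℝ))
    rw [hT.1.pow_eq]
    exact (hg1 n).le
  · refine isBounded_iff_forall_norm_le.2 ⟨C * ‖Z ⟨f, hf⟩‖ + 1, ?_⟩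
    rintro _ ⟨n, rfl⟩
    have b1 : ‖T (r n) (Z ⟨f, hf⟩)‖ ≤ C * ‖Z ⟨f, hf⟩‖ :=
      ((T (r n)).le_opNorm _).trans (by gcongr; exact hC _ (by exact_mod_cast hrle n))
    have b2 : (1 : ℝ) / (n + 1) ≤ 1 := by
      rw [div_le_one (by positivity)]
      linarith [(Nat.cast_nonneg n : (0 : ℝ) ≤ n)]
    have b3 := norm_sub_norm_le (Z (g n)) (T (r n) (Z ⟨f, hf⟩))
    rw [norm_sub_rev] at b3
    linarith [hg2 n]

/-- The semigroup generated by the closure of `Z` satisfies the four conditions. -/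
theorem IsGeneratorOf.conditions [CompleteSpace E] {Z : E →ₗ.[𝕜] E}
    (hZ : Dense (Z.domain : Set E)) (hcl : Z.IsClosable) {T : ℝ≥0 → E →L[𝕜] E}
    (hT : IsGeneratorOf Z.closure T) (t : ℝ≥0) : Conditions Z t T where
  map_zero := hT.1.map_zero
  stable := by
    obtain ⟨M, a, hM, h⟩ := hT.1.bound
    refine ⟨a, M, hM.le, fun n m _ _ s => ?_⟩
    rw [hT.1.pow_eq]
    refine (h _).trans (le_of_eq ?_)
    push_cast
    ring_nf
  extends_Z := hT.2 ▸ Z.le_closure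
  dual_dense := by
    let _ := NormedSpace.restrictScalars ℝ 𝕜 E
    have : IsScalarTower ℝ 𝕜 E := RestrictScalars.isScalarTower ℝ 𝕜 E
    exact hT.1.dual_dense
  approx := ⟨Z.domain, le_rfl, hZ, fun f hf s => hT.exists_approx hcl t hf s⟩

end Necessity

end

end ChernoffGen

theorem mainTheorem10 {𝕜 B : Type*} [RCLike 𝕜] [NormedAddCommGroup B] [NormedSpace 𝕜 B]
    [CompleteSpace B]
    (hB : (ChernoffGen.IsReflexiveSpace 𝕜 B ∧ TopologicalSpace.SeparableSpace B) ∨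
      ChernoffGen.HasInnerProduct 𝕜 B)
    (Z : B →ₗ.[𝕜] B) (hZ : Dense (Z.domain : Set B)) (t : ℝ≥0) (ht : 0 < t) :
    ((Z.IsClosable ∧ ∃ T : ℝ≥0 → B →L[𝕜] B, ChernoffGen.IsGeneratorOf Z.closure T) ↔
      ∃ F : ℝ≥0 → B →L[𝕜] B, ChernoffGen.Conditions Z t F) ∧
    ∀ F : ℝ≥0 → B →L[𝕜] B, ChernoffGen.Conditions Z t F →
      ∀ T : ℝ≥0 → B →L[𝕜] B, ChernoffGen.IsGeneratorOf Z.closure T →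
        ∀ s : ℝ≥0, 0 < s → ∀ f : B,
          Tendsto (fun n : ℕ => (F (s / n) ^ n) f) atTop (𝓝 (T s f)) := by
  have hE : ChernoffGen.IsReflexiveSpace 𝕜 B :=
    hB.elim And.left ChernoffGen.isReflexiveSpace_of_hasInnerProduct
  let _ := NormedSpace.restrictScalars ℝ 𝕜 B
  have : IsScalarTower ℝ 𝕜 B := RestrictScalars.isScalarTower ℝ 𝕜 B
  refine ⟨⟨?_, ?_⟩, fun F hF T hT s hs f =>
    ChernoffGen.tendsto_pow_of_isGeneratorOf hE hZ ht hF hT hs f⟩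
  · rintro ⟨hcl, T, hT⟩
    exact ⟨T, hT.conditions hZ hcl t⟩
  · rintro ⟨F, hF⟩
    obtain ⟨h1, h2, -⟩ := hF.exists_semigroup hE ht
    exact ⟨h1, h2⟩
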